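/- **Theorem 2.** Let $M$ be a smooth manifold of dimension $n\ge 3$ with a Finsler metric $F$, i.e. a continuous function $F\colon TM\to\mathbb R$, smooth off the zero section, with $F(tv)=tF(v)$ for $t>0$, such that the Hessian $g_{ij}=\partial^2E/\partial y^i\partial y^j$ of the energy $E=\tfrac12F^2$ is positive definite at all nonzero tangent vectors; here $(x^i,y^i)$ are the coordinates on $TM$ induced by local coordinates $u^i$ around a point $p\in M$. Let $\alpha\colon M\to\mathbb R$ be a smooth function with $d_p\alpha\ne0$, and put $\alpha_l=\partial\alpha/\partial u^l$ and $(g^{ij})=(g_{ij})^{-1}$. Let $$G^l=\tfrac12 g^{lm}\Big(y^k\frac{\partial^2E}{\partial y^m\partial x^k}-\frac{\partial E}{\partial x^m}\Big),\qquad P^l_{ijk}=-\frac{\partial^3G^l}{\partial y^i\partial y^j\partial y^k}$$ be the spray coefficients and the mixed curvature of the Berwald connection of $F$, and let $\tilde P^l_{ijk}$ be the mixed curvature of $\tilde F=e^{\alpha}F$. Suppose that - the indicatrix hypersurface $\{v\in T_pM: 2E(v)=F(v)^2=1\}$, with the Riemannian metric induced by $g_{ij}$, has positive sectional curvature, and -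 $\tilde P^l_{ijk}\alpha_l=P^l_{ijk}\alpha_l$ for all $i,j,k$ at all nonzero $v\in T_pM$. Let $X^l=g^{lm}\alpha_m$ be the Riemann–Finsler gradient and $E_*=E\,X^l\alpha_l$ on $T_pM$ (with $E_*(0)=0$). Then: 1. $E_*$ is a positive definite quadratic form on $T_pM$; hence $g^*_{ij}=\partial^2E_*/\partial y^i\partial y^j$ is constant and invertible on $T_pM\setminus\{0\}$, and the Riemannian gradient $X_*^l=g_*^{lk}\alpha_k$, where $(g_*^{ij})=(g^*_{ij})^{-1}$, is one vector $X_*(p)\in T_pM$, independent of $v$. 2. At every nonzero $v\in T_pM$ the vectors $X=X^l\frac{\partial}{\partial y^l}$, $X_*=X_*^l\frac{\partial}{\partial y^l}$ and the Liouville vector $C=y^l\frac{\partial}{\partial y^l}$ are linearly dependent, i.e. their Gram determinant with respect to $g_{ij}$ vanishes. 3. Let $v\in T_pM$ with $d_p\alpha(v)=0$, and put $c(t)=v+tX_*(p)$, $a^2=2E_*(v)$, $b^2=2E_*(X_*(p))$, $y=E\circ c$ and $z=y'/y$. For every $t$ if $v\neq 0$, and for every $t\ne0$ if $v=0$, one has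 $c(t)\neq0$ and $y(t)>0$, $y$ is of class $C^2$ near $t$, $z$ is differentiable at $t$, and $$0=\big(a^2+t^2b^2(1-b^2)\big)\,y\,y''-\tfrac12(a^2+t^2b^2)(y')^2+2tb^4\,y\,y'-2b^4y^2,$$ $$0=\big(a^2+t^2b^2(1-b^2)\big)\,z'+\tfrac12\big(a^2+t^2b^2(1-2b^2)\big)z^2+2tb^4z-2b^4 .$$ -/

import Mathlib

open scoped Manifold ContDiff

noncomputable section

namespace FinslerConformal

/-- The coordinate space `ℝⁿ`. -/
abbrev Vec (n : ℕ) : Type := EuclideanSpace ℝ (Fin n)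

/-- The partial derivative `∂f/∂zⁱ`. -/
def pd {n : ℕ} (i : Fin n) (f : Vec n → ℝ) (z : Vec n) : ℝ :=
  fderiv ℝ f z (EuclideanSpace.single i 1)

/-! ### Sectional curvature of a Riemannian metric given in coordinates -/

section Riemannian

variable {m : ℕ}

/-- Christoffel symbols `Γᵏᵢⱼ = ½ hᵏˡ (∂ᵢ hⱼₗ + ∂ⱼ hᵢₗ - ∂ₗ hᵢⱼ)`. -/
def christoffel (h : Vec m → Matrix (Fin m) (Fin m) ℝ) (k i j : Fin m) (s : Vec m) : ℝ :=
  (1 / 2) * ∑ l, (h s)⁻¹ k l *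
    (pd i (fun s' => h s' j l) s + pd j (fun s' => h s' i l) s - pd l (fun s' => h s' i j) s)

/-- Riemann curvature components, `R(∂ᵢ, ∂ⱼ) ∂ₖ = Rˡₖᵢⱼ ∂ₗ` with
`R(U, V) = ∇_U ∇_V - ∇_V ∇_U - ∇_[U,V]`. -/
def riemann (h : Vec m → Matrix (Fin m) (Fin m) ℝ) (l k i j : Fin m) (s : Vec m) : ℝ :=
  pd i (christoffel h l j k) s - pd j (christoffel h l i k) s
    + ∑ r, (christoffel h l i r s * christoffel h r j k s
          - christoffel h l j r s * christoffel h r i k s)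

/-- The sectional curvature `h(R(u, w) w, u) / (h(u,u) h(w,w) - h(u,w)²)` at `s`. -/
def sectionalCurvature (h : Vec m → Matrix (Fin m) (Fin m) ℝ) (s u w : Vec m) : ℝ :=
  (∑ a, ∑ l, ∑ k, ∑ i, ∑ j, h s a l * riemann h l k i j s * u i * w j * w k * u a) /
    ((∑ a, ∑ b, h s a b * u a * u b) * (∑ a, ∑ b, h s a b * w a * w b)
      - (∑ a, ∑ b, h s a b * u a * w b) ^ 2)

end Riemannian

/-! ### Quantities in a single tangent space, in linear coordinates `y`

`L` is the energy `y ↦ E(y)` of the tangent space and `a = (αₗ)` are the components of a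
covector. -/

section Fibre

variable {n : ℕ}

/-- The Hessian `∂²L/∂yⁱ∂yʲ`; for `L = E` this is the Riemann-Finsler metric `gᵢⱼ`. -/
def hess (L : Vec n → ℝ) (y : Vec n) : Matrix (Fin n) (Fin n) ℝ :=
  Matrix.of fun i j => pd j (pd i L) y

/-- The gradient `gˡᵐ aₘ` of the covector `a` with respect to `gᵢⱼ = ∂²L/∂yⁱ∂yʲ`. -/
def grad (L : Vec n → ℝ) (a : Fin n → ℝ) (y : Vec n) : Vec n :=
  WithLp.toLp 2 (Matrix.mulVec (hess L y)⁻¹ a)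

/-- The associated energy `E_* = E · Xˡ aₗ`, where `Xˡ = gˡᵐ aₘ`. -/
def energyStar (L : Vec n → ℝ) (a : Fin n → ℝ) (y : Vec n) : ℝ :=
  L y * ∑ l, grad L a y l * a l

/-- The gradient `X_*ˡ = g_*ˡᵏ aₖ` of `a` with respect to the Hessian `g*` of `E_*`. -/
def gradStar (L : Vec n → ℝ) (a : Fin n → ℝ) (y : Vec n) : Vec n :=
  grad (energyStar L a) a y

/-- The Gram determinant of three vectors with respect to the metric `gᵢⱼ` at `y`. -/
def gramDet (L : Vec n → ℝ) (y : Vec n) (u : Fin 3 → Vec n) : ℝ :=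
  Matrix.det (Matrix.of fun r s : Fin 3 => ∑ i, ∑ j, hess L y i j * u r i * u s j)

/-- A local parametrization, over an open set `U`, of the indicatrix hypersurface
`{y | 2 E(y) = 1}`: a smooth immersion of `U` with values in the indicatrix. -/
structure IsIndicatrixParam (L : Vec n → ℝ) (U : Set (Vec (n - 1)))
    (φ : Vec (n - 1) → Vec n) : Prop where
  isOpen : IsOpen U
  smooth : ContDiffOn ℝ ∞ φ U
  immersion : ∀ s ∈ U, Function.Injective (fderiv ℝ φ s)
  mem : ∀ s ∈ U, 2 * L (φ s) = 1

/-- The metric induced by `gᵢⱼ` on a parametrized hypersurface. -/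
def inducedMetric (L : Vec n → ℝ) (φ : Vec (n - 1) → Vec n) (s : Vec (n - 1)) :
    Matrix (Fin (n - 1)) (Fin (n - 1)) ℝ :=
  Matrix.of fun a b => ∑ i, ∑ j, hess L (φ s) i j *
    fderiv ℝ φ s (EuclideanSpace.single a 1) i * fderiv ℝ φ s (EuclideanSpace.single b 1) j

/-- All sectional curvatures of the indicatrix hypersurface, with the metric induced by
`gᵢⱼ`, are positive. -/
def IndicatrixPositivelyCurved (L : Vec n → ℝ) : Prop :=
  ∀ (U : Set (Vec (n - 1))) (φ : Vec (n - 1) → Vec n), IsIndicatrixParam L U φ →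
    ∀ s ∈ U, ∀ u w : Vec (n - 1), LinearIndependent ℝ ![u, w] →
      0 < sectionalCurvature (inducedMetric L φ) s u w

end Fibre

/-! ### Spray and Berwald curvature in induced coordinates `(x, y)`; `L x y` is the energy -/

section Spray

variable {n : ℕ}

/-- The geodesic spray coefficients
`Gˡ = ½ gˡᵐ (yᵏ ∂²E/∂yᵐ∂xᵏ - ∂E/∂xᵐ)`. -/
def spray (L : Vec n → Vec n → ℝ) (l : Fin n) (x y : Vec n) : ℝ :=
  (1 / 2) * ∑ m, (hess (L x) y)⁻¹ l m *
    ((∑ k, y k * pd k (fun x' => pd m (L x') y) x) - pd m (fun x' => L x' y) x)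

/-- The mixed curvature `Pˡᵢⱼₖ = -∂³Gˡ/∂yⁱ∂yʲ∂yᵏ` of the Berwald connection. -/
def berwaldMixed (L : Vec n → Vec n → ℝ) (l i j k : Fin n) (x y : Vec n) : ℝ :=
  - pd k (pd j (pd i (spray L l x))) y

end Spray

/-! ### Finsler metrics on manifolds -/

section Manifold

variable {n : ℕ} {M : Type*} [TopologicalSpace M] [ChartedSpace (Vec n) M]
  [IsManifold (𝓡 n) ∞ M]

/-- The energy `E = ½ F²`. -/
def energy (F : TangentBundle (𝓡 n) M → ℝ) (v : TangentBundle (𝓡 n) M) : ℝ :=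
  (1 / 2) * F v ^ 2

/-- Finsler metrics: continuous, smooth off the zero section, positively homogeneous, and
strongly convex. The tangent space at `q` is, as a vector space, `ℝⁿ`, so the second derivative
of the energy along it makes sense. -/
structure IsFinslerMetric (F : TangentBundle (𝓡 n) M → ℝ) : Prop where
  continuous : Continuous F
  smooth : ContMDiffOn (𝓡 n).tangent 𝓘(ℝ, ℝ) ∞ F {v | v.2 ≠ 0}
  homogeneous : ∀ (q : M) (v : TangentSpace (𝓡 n) q) (t : ℝ), 0 < t →
    F ⟨q, t • v⟩ = t * F ⟨q, v⟩
  convex : ∀ (q : M) (v w : Vec n), v ≠ 0 → w ≠ 0 →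
    0 < fderiv ℝ (fderiv ℝ fun y : Vec n => energy F ⟨q, y⟩) v w w

/-- The conformal change `e^α F`. -/
def conformalChange (α : M → ℝ) (F : TangentBundle (𝓡 n) M → ℝ)
    (v : TangentBundle (𝓡 n) M) : ℝ :=
  Real.exp (α v.1) * F v

/-- The energy in the coordinates `(x, y)` of the tangent bundle induced by a chart `e`:
`(x, y)` stands for the tangent vector `yⁱ ∂/∂uⁱ` at the point with coordinates `x`. -/
def coordEnergy (e : OpenPartialHomeomorph M (Vec n)) (F : TangentBundle (𝓡 n) M → ℝ)
    (x y : Vec n) : ℝ :=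
  energy F ⟨e.symm x, mfderiv (𝓡 n) (𝓡 n) e.symm x y⟩

/-- The coordinates `(yⁱ(v))` of a tangent vector `v` at `p`. -/
def tangentCoord (e : OpenPartialHomeomorph M (Vec n)) (p : M) (v : TangentSpace (𝓡 n) p) :
    Vec n :=
  mfderiv (𝓡 n) (𝓡 n) e p v

/-- The partial derivatives `αₗ = ∂α/∂uˡ` at the point `p`. -/
def coordDeriv (e : OpenPartialHomeomorph M (Vec n)) (α : M → ℝ) (p : M) (l : Fin n) : ℝ :=
  pd l (fun x => α (e.symm x)) (e p)

end Manifold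

end FinslerConformal

end

open FinslerConformal

/-!
Conformal invariance of the contracted curvature says that the third derivatives of `E_*` vanish,
so `E_*` is a quadratic form `½ B`, and `α(X) = ½ B / E` on the tangent space. At the points where
`α(X)` is extremal on the unit sphere of `B` the Hessians of `E` and of `½ B` can be compared, which
gives `α(X_*) = 1`. Along a line `t ↦ v + t X_*` the Wronskian of `E` and `½ B` is then monotone by
the Cauchy-Schwarz inequality. Its limits at `±∞` exist, because the first derivatives of `E` and
`B` are homogeneous, and they are exchanged up to sign when `v` is replaced by `-v`; this
forces the Wronskian to be constant. Hence `α(X)` is monotone along each line, from its value at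
`-X_*` to its value at `X_*`, in opposite senses for `v` and `-v`, so it is constant. Therefore `E`
is a multiple of `½ B`, `X` is a multiple of `X_*`, and along `c` the energy is a quadratic
polynomial.
-/

open Filter Topology

namespace FinslerConformal

section Forms

variable {V : Type*} [NormedAddCommGroup V] [NormedSpace ℝ V]

/-- Inner products on `V`, encoded as continuous bilinear forms `V →L[ℝ] V →L[ℝ] ℝ`. -/
structure IsPosDefForm (B : V →L[ℝ] V →L[ℝ] ℝ) : Prop where
  symm : ∀ u w, B u w = B w u
  pos : ∀ u, u ≠ 0 → 0 < B u u

/-- The vector representing a covector with respect to a bilinear form (the musical isomorphism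
`♯`); it is `0` if the form is degenerate. -/
noncomputable def sharp (B : V →L[ℝ] V →L[ℝ] ℝ) (α : V →L[ℝ] ℝ) : V := B.inverse α

/-- The quadratic function `½ B(y, y)`. -/
noncomputable def formEnergy (B : V →L[ℝ] V →L[ℝ] ℝ) (y : V) : ℝ := 1 / 2 * B y y

/-- The Hessian of `f` at `y`, as a bilinear form. -/
noncomputable abbrev hessForm (f : V → ℝ) (y : V) : V →L[ℝ] V →L[ℝ] ℝ := fderiv ℝ (fderiv ℝ f) y

variable {B : V →L[ℝ] V →L[ℝ] ℝ} {α : V →L[ℝ] ℝ}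

lemma sharp_neg (B : V →L[ℝ] V →L[ℝ] ℝ) (α : V →L[ℝ] ℝ) : sharp B (-α) = -sharp B α :=
  map_neg _ _

lemma sharp_add (B : V →L[ℝ] V →L[ℝ] ℝ) (α β : V →L[ℝ] ℝ) :
    sharp B (α + β) = sharp B α + sharp B β := map_add _ _ _

lemma sharp_sub (B : V →L[ℝ] V →L[ℝ] ℝ) (α β : V →L[ℝ] ℝ) :
    sharp B (α - β) = sharp B α - sharp B β := map_sub _ _ _

lemma sharp_smul (B : V →L[ℝ] V →L[ℝ] ℝ) (c : ℝ) (α : V →L[ℝ] ℝ) :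
    sharp B (c • α) = c • sharp B α := map_smul _ _ _

namespace IsPosDefForm

lemma nonneg (hB : IsPosDefForm B) (u : V) : 0 ≤ B u u := by
  rcases eq_or_ne u 0 with rfl | hu
  · simp
  · exact (hB.pos u hu).le

lemma sq_apply_le (hB : IsPosDefForm B) (u w : V) : B u w ^ 2 ≤ B u u * B w w :=
  LinearMap.BilinForm.apply_sq_le_of_symm B.toLinearMap₁₂ hB.nonneg ⟨fun u w => hB.symm u w⟩ u w

lemma injective (hB : IsPosDefForm B) : Function.Injective B :=
  (injective_iff_map_eq_zero B).2 fun u hu => by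
    by_contra hne
    simpa [hu] using hB.pos u hne

lemma const_smul (hB : IsPosDefForm B) {c : ℝ} (hc : 0 < c) : IsPosDefForm (c • B) where
  symm u w := congrArg (c * ·) (hB.symm u w)
  pos u hu := mul_pos hc (hB.pos u hu)

variable [FiniteDimensional ℝ V]

lemma isInvertible (hB : IsPosDefForm B) : B.IsInvertible := by
  have hdim : Module.finrank ℝ V = Module.finrank ℝ (V →L[ℝ] ℝ) :=
    (Subspace.dual_finrank_eq (K := ℝ) (V := V)).symm.trans
      (LinearMap.toContinuousLinearMap (𝕜 := ℝ) (E := V) (F' := ℝ)).finrank_eq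
  let e := LinearEquiv.ofInjectiveOfFinrankEq B.toLinearMap hB.injective hdim
  exact ⟨e.toContinuousLinearEquiv, rfl⟩

lemma apply_sharp (hB : IsPosDefForm B) (α : V →L[ℝ] ℝ) : B (sharp B α) = α :=
  hB.isInvertible.self_apply_inverse α

lemma sharp_eq (hB : IsPosDefForm B) {u : V} (hu : B u = α) : sharp B α = u :=
  hB.injective ((hB.apply_sharp α).trans hu.symm)

lemma sharp_ne_zero (hB : IsPosDefForm B) (hα : α ≠ 0) : sharp B α ≠ 0 := fun h0 =>
  hα (by rw [← hB.apply_sharp α, h0, map_zero])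

lemma apply_sharp_pos (hB : IsPosDefForm B) (hα : α ≠ 0) : 0 < α (sharp B α) := by
  simpa only [hB.apply_sharp] using hB.pos _ (hB.sharp_ne_zero hα)

lemma sharp_smul_smul (hB : IsPosDefForm B) {c : ℝ} (hc : 0 < c) (α : V →L[ℝ] ℝ) :
    sharp (c • B) (c • α) = sharp B α :=
  (hB.const_smul hc).sharp_eq (by rw [smul_apply, hB.apply_sharp])

end IsPosDefForm

lemma contDiffAt_formEnergy {k : WithTop ℕ∞} (B : V →L[ℝ] V →L[ℝ] ℝ) (y : V) :
    ContDiffAt ℝ k (formEnergy B) y :=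
  contDiffAt_const.mul (B.contDiff.contDiffAt.clm_apply contDiffAt_id)

lemma hasFDerivAt_formEnergy (hB : ∀ u w, B u w = B w u) (y : V) :
    HasFDerivAt (formEnergy B) (B y) y := by
  have h := (B.hasFDerivAt.clm_apply (hasFDerivAt_id y)).const_mul (1 / 2)
  refine h.congr_fderiv (ContinuousLinearMap.ext fun w => ?_)
  simp [hB w y]
  ring

lemma hessForm_formEnergy (hB : ∀ u w, B u w = B w u) (y : V) : hessForm (formEnergy B) y = B := by
  have h : fderiv ℝ (formEnergy B) = B := funext fun z => (hasFDerivAt_formEnergy hB z).fderiv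
  rw [hessForm, h, ContinuousLinearMap.fderiv]

lemma hessForm_const_smul (c : ℝ) (f : V → ℝ) (y : V) : hessForm (c • f) y = c • hessForm f y := by
  have : fderiv ℝ (c • f) = c • fderiv ℝ f := fderiv_const_smul_field c
  rw [hessForm, this]
  exact congrFun (fderiv_const_smul_field (𝕜 := ℝ) (f := fderiv ℝ f) c) y

lemma contDiffAt_sharp [FiniteDimensional ℝ V] {E : Type*} [NormedAddCommGroup E] [NormedSpace ℝ E]
    {k : WithTop ℕ∞} {G : E → V →L[ℝ] V →L[ℝ] ℝ} {β : E → V →L[ℝ] ℝ} {z : E}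
    (hG : ContDiffAt ℝ k G z) (hβ : ContDiffAt ℝ k β z) (hz : IsPosDefForm (G z)) :
    ContDiffAt ℝ k (fun z => sharp (G z) (β z)) z := by
  have := FiniteDimensional.complete ℝ V
  exact (ContDiffAt.comp z hz.isInvertible.contDiffAt_map_inverse hG).clm_apply hβ

end Forms

section Homogeneous

variable {V E : Type*} [NormedAddCommGroup V] [NormedSpace ℝ V] [NormedAddCommGroup E]
  [NormedSpace ℝ E]

/-- Positive homogeneity of degree `k`. -/
def IsPosHomogeneous (k : ℤ) (f : V → E) : Prop :=
  ∀ (y : V) (t : ℝ), 0 < t → f (t • y) = t ^ k • f y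

variable {k : ℤ} {f : V → E} {y : V}

namespace IsPosHomogeneous

protected lemma fderiv (h : IsPosHomogeneous k f) : IsPosHomogeneous (k - 1) (fderiv ℝ f) := by
  intro y t ht
  have hscale : t • fderiv ℝ f (t • y) = t ^ k • fderiv ℝ f y := by
    rw [← fderiv_comp_smul, funext fun z => h z t ht]
    exact congrFun (fderiv_const_smul_field (t ^ k)) y
  rw [zpow_sub_one₀ ht.ne', mul_comm, mul_smul, ← hscale, inv_smul_smul₀ ht.ne']

lemma fderiv_apply_self (h : IsPosHomogeneous k f) (hf : DifferentiableAt ℝ f y) :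
    fderiv ℝ f y y = (k : ℝ) • f y := by
  have hray : HasDerivAt (fun t : ℝ => f (t • y)) (fderiv ℝ f y y) 1 := by
    have hline : HasDerivAt (fun t : ℝ => t • y) y 1 := by
      simpa using (hasDerivAt_id (1 : ℝ)).smul_const y
    rw [← one_smul ℝ y] at hf
    simpa only [one_smul, Function.comp_def] using hf.hasFDerivAt.comp_hasDerivAt (1 : ℝ) hline
  have hpow : HasDerivAt (fun t : ℝ => t ^ k • f y) ((k : ℝ) • f y) 1 := by
    simpa using (hasDerivAt_zpow k (1 : ℝ) (.inl one_ne_zero)).smul_const (f y)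
  refine hray.unique (hpow.congr_of_eventuallyEq ?_)
  filter_upwards [lt_mem_nhds (zero_lt_one' ℝ)] with t ht using h y t ht

end IsPosHomogeneous

end Homogeneous

section Minkowski

variable {V : Type*} [NormedAddCommGroup V] [NormedSpace ℝ V]

/-- Positively 2-homogeneous functions of class `C³` off the origin. -/
structure IsTwoHomogeneous (L : V → ℝ) : Prop where
  contDiffAt : ∀ y, y ≠ 0 → ContDiffAt ℝ 3 L y
  homogeneous : IsPosHomogeneous 2 L

/-- Energies of Minkowski norms: 2-homogeneous functions with positive definite Hessian. -/
structure IsMinkowskiEnergy (L : V → ℝ) : Prop extends IsTwoHomogeneous L where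
  convex : ∀ y w : V, y ≠ 0 → w ≠ 0 → 0 < hessForm L y w w

namespace IsTwoHomogeneous

variable {L : V → ℝ} {y : V}

lemma map_zero (h : IsTwoHomogeneous L) : L 0 = 0 := by
  have := h.homogeneous 0 2 two_pos
  norm_num at this
  linarith

lemma map_smul (h : IsTwoHomogeneous L) (y : V) {t : ℝ} (ht : 0 < t) :
    L (t • y) = t ^ 2 * L y := h.homogeneous y t ht

lemma differentiableAt (h : IsTwoHomogeneous L) (hy : y ≠ 0) : DifferentiableAt ℝ L y :=
  (h.contDiffAt y hy).differentiableAt (by norm_num)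

lemma contDiffAt_fderiv (h : IsTwoHomogeneous L) (hy : y ≠ 0) : ContDiffAt ℝ 2 (fderiv ℝ L) y :=
  (h.contDiffAt y hy).fderiv_right (by norm_num)

lemma differentiableAt_fderiv (h : IsTwoHomogeneous L) (hy : y ≠ 0) :
    DifferentiableAt ℝ (fderiv ℝ L) y :=
  (h.contDiffAt_fderiv hy).differentiableAt (by norm_num)

lemma contDiffAt_hessForm (h : IsTwoHomogeneous L) (hy : y ≠ 0) : ContDiffAt ℝ 1 (hessForm L) y :=
  (h.contDiffAt_fderiv hy).fderiv_right (by norm_num)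

lemma differentiableAt_hessForm (h : IsTwoHomogeneous L) (hy : y ≠ 0) :
    DifferentiableAt ℝ (hessForm L) y :=
  (h.contDiffAt_hessForm hy).differentiableAt one_ne_zero

lemma hessForm_comm (h : IsTwoHomogeneous L) (hy : y ≠ 0) (u w : V) :
    hessForm L y u w = hessForm L y w u :=
  ((h.contDiffAt y hy).isSymmSndFDerivAt (by simp; norm_num)) u w

lemma fderiv_apply_self (h : IsTwoHomogeneous L) (hy : y ≠ 0) : fderiv ℝ L y y = 2 * L y := by
  simpa using h.homogeneous.fderiv_apply_self (h.differentiableAt hy)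

lemma hessForm_self (h : IsTwoHomogeneous L) (hy : y ≠ 0) : hessForm L y y = fderiv ℝ L y := by
  have := h.homogeneous.fderiv.fderiv_apply_self (h.differentiableAt_fderiv hy)
  norm_num at this
  exact this

lemma hessForm_self_self (h : IsTwoHomogeneous L) (hy : y ≠ 0) : hessForm L y y y = 2 * L y := by
  rw [h.hessForm_self hy, h.fderiv_apply_self hy]

lemma formEnergy_hessForm (h : IsTwoHomogeneous L) (hy : y ≠ 0) :
    formEnergy (hessForm L y) y = L y := by
  rw [formEnergy, h.hessForm_self_self hy]
  ring

lemma fderiv_hessForm_self (h : IsTwoHomogeneous L) (hy : y ≠ 0) :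
    fderiv ℝ (hessForm L) y y = 0 := by
  have := h.homogeneous.fderiv.fderiv.fderiv_apply_self (h.differentiableAt_hessForm hy)
  norm_num at this
  exact this

lemma fderiv_hessForm_apply_self (h : IsTwoHomogeneous L) (hy : y ≠ 0) (v : V) :
    fderiv ℝ (hessForm L) y v y = 0 := by
  have hsymm : IsSymmSndFDerivAt ℝ (fderiv ℝ L) y :=
    (h.contDiffAt_fderiv hy).isSymmSndFDerivAt (by simp)
  rw [hsymm v y, h.fderiv_hessForm_self hy, zero_apply]

lemma fderiv_hessForm_comm (h : IsTwoHomogeneous L) (hy : y ≠ 0) (v u w : V) :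
    fderiv ℝ (hessForm L) y v u w = fderiv ℝ (hessForm L) y v w u := by
  have hd (u w : V) : HasFDerivAt (fun z => hessForm L z u w)
      (((fderiv ℝ (hessForm L) y).flip u).flip w) y := by
    have hG := (h.differentiableAt_hessForm hy).hasFDerivAt
    simpa using (hG.clm_apply (hasFDerivAt_const u y)).clm_apply (hasFDerivAt_const w y)
  have heq := (hd u w).unique ((hd w u).congr_of_eventuallyEq (by
    filter_upwards [isOpen_ne.mem_nhds hy] with z hz using h.hessForm_comm hz u w))
  simpa using DFunLike.congr_fun heq v

lemma fderiv_hessForm_add_smul (h : IsTwoHomogeneous L) (hy : y ≠ 0) (v σ : V) (r : ℝ) :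
    fderiv ℝ (hessForm L) y v (σ + r • y) (σ + r • y) = fderiv ℝ (hessForm L) y v σ σ := by
  simp [h.fderiv_hessForm_apply_self hy, h.fderiv_hessForm_comm hy v σ y]

/-- A 2-homogeneous function is determined by its Hessian, so it is quadratic as soon as the
Hessian is locally constant on the connected set `V \ {0}`. -/
lemma eq_formEnergy_of_fderiv_hessForm_eq_zero (h : IsTwoHomogeneous L)
    (hV : 1 < Module.finrank ℝ V) (hD : ∀ y, y ≠ 0 → fderiv ℝ (hessForm L) y = 0) :
    ∃ B : V →L[ℝ] V →L[ℝ] ℝ, (∀ u w, B u w = B w u) ∧ L = formEnergy B := by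
  have : Nontrivial V := Module.nontrivial_of_finrank_pos (R := ℝ) (by omega)
  obtain ⟨y₀, hy₀⟩ := exists_ne (0 : V)
  have hconst : ∀ y, y ≠ 0 → hessForm L y = hessForm L y₀ := fun y hy =>
    isOpen_compl_singleton.is_const_of_fderiv_eq_zero (𝕜 := ℝ)
      (isConnected_compl_singleton_of_one_lt_rank
        (Module.one_lt_rank_of_one_lt_finrank hV) 0).isPreconnected
      (fun z hz => (h.differentiableAt_hessForm hz).differentiableWithinAt)
      (fun z hz => hD z hz) hy hy₀
  refine ⟨hessForm L y₀, h.hessForm_comm hy₀, funext fun y => ?_⟩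
  rcases eq_or_ne y 0 with rfl | hy
  · simp [formEnergy, h.map_zero]
  · rw [← hconst y hy, h.formEnergy_hessForm hy]

end IsTwoHomogeneous

namespace IsMinkowskiEnergy

variable {L : V → ℝ} {y : V}

lemma isPosDefForm (h : IsMinkowskiEnergy L) (hy : y ≠ 0) : IsPosDefForm (hessForm L y) :=
  ⟨h.hessForm_comm hy, fun w hw => h.convex y w hy hw⟩

lemma pos (h : IsMinkowskiEnergy L) (hy : y ≠ 0) : 0 < L y := by
  have := h.convex y y hy hy
  rw [h.hessForm_self_self hy] at this
  linarith

lemma const_smul (h : IsMinkowskiEnergy L) {c : ℝ} (hc : 0 < c) : IsMinkowskiEnergy (c • L) where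
  contDiffAt y hy := (h.contDiffAt y hy).const_smul c
  homogeneous y t ht := by
    rw [Pi.smul_apply, h.homogeneous y t ht, smul_comm, Pi.smul_apply]
  convex y w hy hw := by
    rw [hessForm_const_smul]
    exact ((h.isPosDefForm hy).const_smul hc).pos w hw

end IsMinkowskiEnergy

/-- The gradient `X` of the covector `α` with respect to the Hessian of `L`. -/
noncomputable def finslerGrad (L : V → ℝ) (α : V →L[ℝ] ℝ) (y : V) : V := sharp (hessForm L y) α

/-- The square `α(X)` of the length of the gradient `X` of `α`. -/
noncomputable def gradSq (L : V → ℝ) (α : V →L[ℝ] ℝ) (y : V) : ℝ := α (finslerGrad L α y)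

/-- The associated energy `E_* = L α(X)`; the coordinate-free form of `energyStar`. -/
noncomputable def assocEnergy (L : V → ℝ) (α : V →L[ℝ] ℝ) (y : V) : ℝ := L y * gradSq L α y

lemma IsTwoHomogeneous.isPosHomogeneous_gradSq {L : V → ℝ} (h : IsTwoHomogeneous L)
    (α : V →L[ℝ] ℝ) : IsPosHomogeneous 0 (gradSq L α) := by
  intro y t ht
  have hhess := h.homogeneous.fderiv.fderiv y t ht
  norm_num at hhess
  rw [zpow_zero, one_smul, gradSq, finslerGrad, hessForm, hhess, gradSq, finslerGrad]

lemma finslerGrad_neg (L : V → ℝ) (α : V →L[ℝ] ℝ) (y : V) :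
    finslerGrad L (-α) y = -finslerGrad L α y := sharp_neg _ _

lemma gradSq_neg (L : V → ℝ) (α : V →L[ℝ] ℝ) (y : V) : gradSq L (-α) y = gradSq L α y := by
  simp [gradSq, finslerGrad_neg]

namespace IsMinkowskiEnergy

variable {L : V → ℝ} (h : IsMinkowskiEnergy L) {α : V →L[ℝ] ℝ} {y : V} [FiniteDimensional ℝ V]
include h

lemma hessForm_finslerGrad (hy : y ≠ 0) : hessForm L y (finslerGrad L α y) = α :=
  (h.isPosDefForm hy).apply_sharp α

lemma differentiableAt_finslerGrad (hy : y ≠ 0) : DifferentiableAt ℝ (finslerGrad L α) y :=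
  (contDiffAt_sharp (h.contDiffAt_hessForm hy) contDiffAt_const
    (h.isPosDefForm hy)).differentiableAt one_ne_zero

lemma differentiableAt_gradSq (hy : y ≠ 0) : DifferentiableAt ℝ (gradSq L α) y :=
  α.differentiableAt.comp y (h.differentiableAt_finslerGrad hy)

lemma gradSq_eq_hessForm (hy : y ≠ 0) :
    gradSq L α y = hessForm L y (finslerGrad L α y) (finslerGrad L α y) := by
  rw [h.hessForm_finslerGrad hy, gradSq]

lemma gradSq_pos (hα : α ≠ 0) (hy : y ≠ 0) : 0 < gradSq L α y :=
  (h.isPosDefForm hy).apply_sharp_pos hα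

lemma sq_apply_le_gradSq_mul (hy : y ≠ 0) (w : V) :
    α w ^ 2 ≤ gradSq L α y * hessForm L y w w := by
  simpa only [h.hessForm_finslerGrad hy, gradSq] using
    (h.isPosDefForm hy).sq_apply_le (finslerGrad L α y) w

lemma fderiv_gradSq (hy : y ≠ 0) (w : V) : fderiv ℝ (gradSq L α) y w =
    -fderiv ℝ (hessForm L) y w (finslerGrad L α y) (finslerGrad L α y) := by
  set X := finslerGrad L α
  have hXd := (h.differentiableAt_finslerGrad (α := α) hy).hasFDerivAt
  have hgrad : HasFDerivAt (fun z => hessForm L z (X z)) 0 y :=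
    (hasFDerivAt_const (𝕜 := ℝ) α y).congr_of_eventuallyEq (by
      filter_upwards [isOpen_ne.mem_nhds hy] with z hz using h.hessForm_finslerGrad hz)
  have hprod : hessForm L y (fderiv ℝ X y w) + fderiv ℝ (hessForm L) y w (X y) = 0 := by
    simpa using DFunLike.congr_fun
      (((h.differentiableAt_hessForm hy).hasFDerivAt.clm_apply hXd).unique hgrad) w
  have hchain : fderiv ℝ (gradSq L α) y w = α (fderiv ℝ X y w) := by
    have := (α.hasFDerivAt.comp y hXd).fderiv
    exact DFunLike.congr_fun this w
  rw [hchain, ← h.hessForm_finslerGrad (α := α) hy, h.hessForm_comm hy,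
    eq_neg_of_add_eq_zero_left hprod, neg_apply]

end IsMinkowskiEnergy

end Minkowski

section Calculus

variable {V E : Type*} [NormedAddCommGroup V] [NormedSpace ℝ V] [NormedAddCommGroup E]
  [NormedSpace ℝ E]

lemma hasDerivAt_comp_line {f : V → E} {v w : V} {t : ℝ} (hf : DifferentiableAt ℝ f (v + t • w)) :
    HasDerivAt (fun s : ℝ => f (v + s • w)) (fderiv ℝ f (v + t • w) w) t := by
  have hline : HasDerivAt (fun s : ℝ => v + s • w) w t := by
    simpa using ((hasDerivAt_id t).smul_const w).const_add v
  exact hf.hasFDerivAt.comp_hasDerivAt t hline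

lemma eventually_comp_line {P : V → Prop} {v w : V} {t : ℝ} (h : ∀ᶠ z in 𝓝 (v + t • w), P z) :
    ∀ᶠ s : ℝ in 𝓝 t, P (v + s • w) := by
  have hline : ContinuousAt (fun s : ℝ => v + s • w) t := by fun_prop
  exact hline.eventually h

lemma hasDerivAt_fderiv_comp_line {f : V → ℝ} {v w : V} {t : ℝ}
    (hf : ContDiffAt ℝ 2 f (v + t • w)) :
    HasDerivAt (fun s : ℝ => fderiv ℝ f (v + s • w) w) (hessForm f (v + t • w) w w) t := by
  simpa using (hasDerivAt_comp_line ((hf.fderiv_right (m := 1) (by norm_num)).differentiableAt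
    one_ne_zero)).clm_apply (hasDerivAt_const t w)

lemma deriv_deriv_nonneg_of_isLocalMin {φ : ℝ → ℝ} {t : ℝ} (hmin : IsLocalMin φ t)
    (hφ : ContinuousAt φ t) : 0 ≤ deriv (deriv φ) t := by
  by_contra! hneg
  have hmax : IsLocalMax φ t := isLocalMax_of_deriv_deriv_neg hneg hmin.deriv_eq_zero hφ
  have hconst : φ =ᶠ[𝓝 t] fun _ => φ t := by
    filter_upwards [hmin, hmax] with s hs hs' using le_antisymm hs' hs
  have hzero : deriv (deriv φ) t = 0 := by
    rw [hconst.deriv.deriv_eq]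
    simp
  exact hneg.ne hzero

lemma hessForm_nonneg_of_isLocalMin {f : V → ℝ} {x : V} (hmin : IsLocalMin f x)
    (hf : ContDiffAt ℝ 2 f x) (w : V) : 0 ≤ hessForm f x w w := by
  have hx : x + (0 : ℝ) • w = x := by simp
  rw [← hx] at hmin hf
  have hderiv : deriv (fun s : ℝ => f (x + s • w)) =ᶠ[𝓝 0] fun s => fderiv ℝ f (x + s • w) w := by
    filter_upwards [eventually_comp_line (hf.eventually (by simp))] with s hs
    exact (hasDerivAt_comp_line (hs.differentiableAt two_ne_zero)).deriv
  have hmin' : IsLocalMin (fun s : ℝ => f (x + s • w)) 0 :=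
    eventually_comp_line (P := fun z => f (x + (0 : ℝ) • w) ≤ f z) hmin
  have hnonneg := deriv_deriv_nonneg_of_isLocalMin hmin'
    (hasDerivAt_comp_line (hf.differentiableAt two_ne_zero)).continuousAt
  rwa [hderiv.deriv_eq, (hasDerivAt_fderiv_comp_line hf).deriv, hx] at hnonneg

lemma hessForm_le_of_eventually_le {f g : V → ℝ} {x : V} (hf : ContDiffAt ℝ 2 f x)
    (hg : ContDiffAt ℝ 2 g x) (hle : ∀ᶠ z in 𝓝 x, f z ≤ g z) (heq : f x = g x) (w : V) :
    hessForm f x w w ≤ hessForm g x w w := by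
  have hmin : IsLocalMin (g - f) x := by
    filter_upwards [hle] with z hz
    simpa [heq] using hz
  have hsub : hessForm (g - f) x = hessForm g x - hessForm f x := by
    have : fderiv ℝ (g - f) =ᶠ[𝓝 x] fderiv ℝ g - fderiv ℝ f := by
      filter_upwards [hf.eventually (by simp), hg.eventually (by simp)] with z hz hz'
      exact fderiv_sub (hz'.differentiableAt two_ne_zero) (hz.differentiableAt two_ne_zero)
    rw [hessForm, this.fderiv_eq]
    exact fderiv_sub ((hg.fderiv_right (m := 1) (by norm_num)).differentiableAt one_ne_zero)
      ((hf.fderiv_right (m := 1) (by norm_num)).differentiableAt one_ne_zero)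
  have := hessForm_nonneg_of_isLocalMin hmin (hg.sub hf) w
  rw [hsub] at this
  simpa using this

lemma tendsto_clm_apply {ι G : Type*} [NormedAddCommGroup G] [NormedSpace ℝ G] {l : Filter ι}
    {T : ι → E →L[ℝ] G} {T₀ : E →L[ℝ] G} {u : ι → E} {u₀ : E} (hT : Tendsto T l (𝓝 T₀))
    (hu : Tendsto u l (𝓝 u₀)) : Tendsto (fun i => T i (u i)) l (𝓝 (T₀ u₀)) :=
  (isBoundedBilinearMap_apply.continuous.tendsto (T₀, u₀)).comp (hT.prodMk_nhds hu)

/-- The Wronskian `f g' - g f'` of `f` and `g` along the line `t ↦ v + t w`. -/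
noncomputable def wronskian (f g : V → ℝ) (w v : V) (t : ℝ) : ℝ :=
  f (v + t • w) * fderiv ℝ g (v + t • w) w - g (v + t • w) * fderiv ℝ f (v + t • w) w

lemma wronskian_neg (f g : V → ℝ) (w v : V) (t : ℝ) :
    wronskian f g (-w) v (-t) = -wronskian f g w v t := by
  simp only [wronskian, neg_smul_neg, map_neg]
  ring

lemma hasDerivAt_wronskian {f g : V → ℝ} {w v : V} {t : ℝ} (hf : ContDiffAt ℝ 2 f (v + t • w))
    (hg : ContDiffAt ℝ 2 g (v + t • w)) :
    HasDerivAt (wronskian f g w v) (f (v + t • w) * hessForm g (v + t • w) w w -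
      g (v + t • w) * hessForm f (v + t • w) w w) t := by
  refine (((hasDerivAt_comp_line (hf.differentiableAt two_ne_zero)).mul
    (hasDerivAt_fderiv_comp_line hg)).sub
    ((hasDerivAt_comp_line (hg.differentiableAt two_ne_zero)).mul
    (hasDerivAt_fderiv_comp_line hf))).congr_deriv ?_
  ring

lemma wronskian_mul {f r : V → ℝ} {w v : V} {t : ℝ} (hf : DifferentiableAt ℝ f (v + t • w))
    (hr : DifferentiableAt ℝ r (v + t • w)) :
    wronskian f (f * r) w v t = f (v + t • w) ^ 2 * fderiv ℝ r (v + t • w) w := by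
  rw [wronskian, fderiv_mul hf hr]
  simp
  ring

lemma IsPosHomogeneous.exists_forall_le [FiniteDimensional ℝ V] [Nontrivial V] {f : V → ℝ}
    (h : IsPosHomogeneous 0 f) (hf : ContinuousOn f {0}ᶜ) :
    ∃ y₀, y₀ ≠ 0 ∧ ∀ y, y ≠ 0 → f y₀ ≤ f y := by
  have : ProperSpace V := FiniteDimensional.proper ℝ V
  have hsub : Metric.sphere (0 : V) 1 ⊆ {0}ᶜ := fun y hy => ne_zero_of_mem_unit_sphere ⟨y, hy⟩
  obtain ⟨y₀, hy₀, hmin⟩ := (isCompact_sphere (0 : V) 1).exists_isMinOn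
    (NormedSpace.sphere_nonempty.2 zero_le_one) (hf.mono hsub)
  refine ⟨y₀, hsub hy₀, fun y hy => ?_⟩
  have hy' : ‖y‖⁻¹ • y ∈ Metric.sphere (0 : V) 1 := by simp [norm_smul, norm_ne_zero_iff.2 hy]
  simpa [h y _ (inv_pos.2 (norm_pos_iff.2 hy))] using hmin hy'

lemma IsPosHomogeneous.neg {k : ℤ} {f : V → E} (h : IsPosHomogeneous k f) :
    IsPosHomogeneous k (-f) := fun y t ht => by simp [h y t ht]

end Calculus

section Rigidity

variable {V : Type*} [NormedAddCommGroup V] [NormedSpace ℝ V]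

lemma add_smul_ne_zero {u v : V} (h : LinearIndependent ℝ ![u, v]) (t : ℝ) : v + t • u ≠ 0 :=
  fun h0 => one_ne_zero (LinearIndependent.pair_iff.1 h t 1 (by rw [one_smul, add_comm, h0])).2

/-- The situation of the rigidity theorem in one tangent space: the energy `L`, a nonzero covector
`α`, and the positive definite form `B` with `E_* = ½ B`. The vector `sharp B α` is `X_*`. -/
structure HasAssocForm (L : V → ℝ) (α : V →L[ℝ] ℝ) (B : V →L[ℝ] V →L[ℝ] ℝ) : Prop
    extends IsMinkowskiEnergy L where
  ne_zero : α ≠ 0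
  posDef : IsPosDefForm B
  assocEnergy_eq : assocEnergy L α = formEnergy B

namespace HasAssocForm

variable {L : V → ℝ} {α : V →L[ℝ] ℝ} {B : V →L[ℝ] V →L[ℝ] ℝ}

lemma neg (h : HasAssocForm L α B) : HasAssocForm L (-α) B where
  toIsMinkowskiEnergy := h.toIsMinkowskiEnergy
  ne_zero := neg_ne_zero.2 h.ne_zero
  posDef := h.posDef
  assocEnergy_eq := by
    rw [← h.assocEnergy_eq]
    exact funext fun y => by rw [assocEnergy, assocEnergy, gradSq_neg]

lemma mul_gradSq (h : HasAssocForm L α B) (y : V) : L y * gradSq L α y = 1 / 2 * B y y :=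
  congrFun h.assocEnergy_eq y

variable (h : HasAssocForm L α B) {y v : V}
include h

lemma gradSq_mul_hessForm_le (hy : y ≠ 0) (hmin : ∀ z, z ≠ 0 → gradSq L α y ≤ gradSq L α z)
    (w : V) : gradSq L α y * hessForm L y w w ≤ B w w := by
  have := hessForm_le_of_eventually_le (f := gradSq L α y • L) (g := formEnergy B)
    (((h.contDiffAt y hy).of_le (by norm_num)).const_smul (gradSq L α y))
    (contDiffAt_formEnergy B y)
    (by
      filter_upwards [isOpen_ne.mem_nhds hy] with z hz
      rw [← h.assocEnergy_eq, assocEnergy, mul_comm]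
      exact mul_le_mul_of_nonneg_right (hmin z hz) (h.pos hz).le)
    (by rw [← h.assocEnergy_eq, assocEnergy, mul_comm]; rfl) w
  simpa [hessForm_const_smul, hessForm_formEnergy h.posDef.symm] using this

lemma le_gradSq_mul_hessForm (hy : y ≠ 0) (hmax : ∀ z, z ≠ 0 → gradSq L α z ≤ gradSq L α y)
    (w : V) : B w w ≤ gradSq L α y * hessForm L y w w := by
  have := hessForm_le_of_eventually_le (f := formEnergy B) (g := gradSq L α y • L)
    (contDiffAt_formEnergy B y)
    (((h.contDiffAt y hy).of_le (by norm_num)).const_smul (gradSq L α y))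
    (by
      filter_upwards [isOpen_ne.mem_nhds hy] with z hz
      rw [← h.assocEnergy_eq, assocEnergy, mul_comm]
      exact mul_le_mul_of_nonneg_right (hmax z hz) (h.pos hz).le)
    (by rw [← h.assocEnergy_eq, assocEnergy, mul_comm]; rfl) w
  simpa [hessForm_const_smul, hessForm_formEnergy h.posDef.symm] using this

variable [FiniteDimensional ℝ V]

lemma sharp_ne_zero : sharp B α ≠ 0 := h.posDef.sharp_ne_zero h.ne_zero

lemma apply_sharp_le_one : α (sharp B α) ≤ 1 := by
  have : Nontrivial V := ⟨_, _, h.sharp_ne_zero⟩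
  obtain ⟨y₀, hy₀, hmin⟩ := (h.isPosHomogeneous_gradSq α).exists_forall_le
    fun y hy => (h.differentiableAt_gradSq hy).continuousAt.continuousWithinAt
  have hcomp := h.gradSq_mul_hessForm_le hy₀ hmin (sharp B α)
  have hcs := h.sq_apply_le_gradSq_mul (α := α) hy₀ (sharp B α)
  rw [h.posDef.apply_sharp] at hcomp
  nlinarith [h.posDef.apply_sharp_pos h.ne_zero]

lemma one_le_apply_sharp : 1 ≤ α (sharp B α) := by
  have : Nontrivial V := ⟨_, _, h.sharp_ne_zero⟩
  obtain ⟨y₁, hy₁, hmax⟩ := (h.isPosHomogeneous_gradSq α).neg.exists_forall_le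
    fun y hy => (h.differentiableAt_gradSq hy).neg.continuousAt.continuousWithinAt
  have hcomp := h.le_gradSq_mul_hessForm hy₁ (fun z hz => neg_le_neg_iff.1 (hmax z hz))
    (finslerGrad L α y₁)
  have hcs := h.posDef.sq_apply_le (sharp B α) (finslerGrad L α y₁)
  rw [← h.gradSq_eq_hessForm hy₁] at hcomp
  rw [h.posDef.apply_sharp] at hcs
  have hpos := h.gradSq_pos h.ne_zero hy₁
  have hle := mul_le_mul_of_nonneg_left hcomp (h.posDef.apply_sharp_pos h.ne_zero).le
  refine le_of_mul_le_mul_right ?_ (mul_pos hpos hpos)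
  calc 1 * (gradSq L α y₁ * gradSq L α y₁) = α (finslerGrad L α y₁) ^ 2 := by rw [gradSq]; ring
    _ ≤ _ := hcs.trans hle

lemma apply_sharp_eq_one : α (sharp B α) = 1 :=
  le_antisymm h.apply_sharp_le_one h.one_le_apply_sharp

lemma antitone_wronskian (hv : LinearIndependent ℝ ![sharp B α, v]) :
    Antitone (wronskian L (formEnergy B) (sharp B α) v) := by
  have hderiv (t : ℝ) := hasDerivAt_wronskian (v := v) (t := t) (w := sharp B α)
    ((h.contDiffAt _ (add_smul_ne_zero hv t)).of_le (by norm_num)) (contDiffAt_formEnergy B _)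
  refine antitone_of_deriv_nonpos (fun t => (hderiv t).differentiableAt) fun t => ?_
  have ht := add_smul_ne_zero hv t
  have hcs := h.sq_apply_le_gradSq_mul (α := α) ht (sharp B α)
  rw [h.apply_sharp_eq_one] at hcs
  rw [(hderiv t).deriv, hessForm_formEnergy h.posDef.symm, h.posDef.apply_sharp,
    h.apply_sharp_eq_one, ← h.assocEnergy_eq, assocEnergy]
  nlinarith [h.pos ht]

/-- Equality holds in the Cauchy-Schwarz inequality for `X` and `X_*` at the point `X_*`. -/
lemma finslerGrad_sharp :
    finslerGrad L α (sharp B α) = gradSq L α (sharp B α) • sharp B α := by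
  have h0 := h.sharp_ne_zero
  by_contra hne
  have hpos := h.convex _ _ h0 (sub_ne_zero.2 hne)
  have hstar := h.mul_gradSq (sharp B α)
  rw [h.posDef.apply_sharp, h.apply_sharp_eq_one] at hstar
  simp only [map_sub, map_smul, sub_apply, smul_apply, smul_eq_mul, h.hessForm_finslerGrad h0,
    h.hessForm_comm h0 (sharp B α) (finslerGrad L α _), h.hessForm_self_self h0,
    h.apply_sharp_eq_one] at hpos
  rw [show α (finslerGrad L α (sharp B α)) = gradSq L α (sharp B α) from rfl] at hpos
  exact hpos.ne' (by linear_combination 2 * gradSq L α (sharp B α) * hstar)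

lemma wronskian_eq_mul_fderiv (w : V) {t : ℝ} (ht : v + t • w ≠ 0) :
    wronskian L (formEnergy B) w v t =
      L (v + t • w) ^ 2 * fderiv ℝ (gradSq L α) (v + t • w) w := by
  rw [← wronskian_mul (h.differentiableAt ht) (h.differentiableAt_gradSq ht),
    ← h.assocEnergy_eq]
  rfl

/-- The derivative of `α(X)` annihilates `y` and is homogeneous of degree `-1`; this turns the
direction `X_*` into `v` and makes the expression converge as `ε → 0`. -/
lemma wronskian_inv {w : V} {ε : ℝ} (hε : 0 < ε) (hy : w + ε • v ≠ 0) (c : ℝ) :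
    wronskian L (formEnergy B) w v ε⁻¹ = L (w + ε • v) ^ 2 *
      fderiv ℝ (hessForm L) (w + ε • v) v
        (ε⁻¹ • (finslerGrad L α (w + ε • v) - c • (w + ε • v)))
        (ε⁻¹ • (finslerGrad L α (w + ε • v) - c • (w + ε • v))) := by
  set y := w + ε • v with hyd
  have hscale : v + ε⁻¹ • w = ε⁻¹ • y := by
    rw [hyd, smul_add, inv_smul_smul₀ hε.ne', add_comm]
  have hdir : fderiv ℝ (gradSq L α) y w = -ε * fderiv ℝ (gradSq L α) y v := by
    have hself := (h.isPosHomogeneous_gradSq α).fderiv_apply_self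
      (h.differentiableAt_gradSq hy)
    rw [hyd, map_add, map_smul, ← hyd] at hself
    norm_num at hself
    linarith
  have hfd := h.fderiv_gradSq (α := α) hy v
  set σ := finslerGrad L α y - c • y with hσ
  rw [← sub_add_cancel (finslerGrad L α y) (c • y), h.fderiv_hessForm_add_smul hy, ← hσ] at hfd
  rw [h.wronskian_eq_mul_fderiv _ (by rw [hscale]; exact smul_ne_zero (inv_ne_zero hε.ne') hy),
    hscale, h.map_smul y (inv_pos.2 hε), (h.isPosHomogeneous_gradSq α).fderiv y _ (inv_pos.2 hε)]
  simp only [smul_apply, map_smul, smul_eq_mul, hdir, hfd]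
  norm_num
  field_simp

lemma tendsto_wronskian (hv : LinearIndependent ℝ ![sharp B α, v]) :
    Tendsto (wronskian L (formEnergy B) (sharp B α) v) atTop (𝓝 (L (sharp B α) ^ 2 *
      fderiv ℝ (hessForm L) (sharp B α) v
        (fderiv ℝ (fun y => finslerGrad L α y - gradSq L α (sharp B α) • y) (sharp B α) v)
        (fderiv ℝ (fun y => finslerGrad L α y - gradSq L α (sharp B α) • y) (sharp B α) v))) := by
  have h0 := h.sharp_ne_zero
  have hline : Tendsto (fun ε : ℝ => sharp B α + ε • v) (𝓝[>] 0) (𝓝 (sharp B α)) := by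
    have : ContinuousAt (fun ε : ℝ => sharp B α + ε • v) 0 := by fun_prop
    simpa using this.tendsto.mono_left nhdsWithin_le_nhds
  have hslope : Tendsto (fun ε : ℝ => ε⁻¹ • (finslerGrad L α (sharp B α + ε • v) -
      gradSq L α (sharp B α) • (sharp B α + ε • v))) (𝓝[>] 0) (𝓝 (fderiv ℝ
        (fun y => finslerGrad L α y - gradSq L α (sharp B α) • y) (sharp B α) v)) := by
    have hdiff : DifferentiableAt ℝ (fun y => finslerGrad L α y - gradSq L α (sharp B α) • y)
        (sharp B α) := (h.differentiableAt_finslerGrad h0).sub (by fun_prop)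
    have := (hdiff.hasFDerivAt.hasLineDerivAt v).tendsto_slope_zero_right
    simpa only [h.finslerGrad_sharp, sub_self, sub_zero] using this
  have hD := ((h.contDiffAt_hessForm h0).continuousAt_fderiv one_ne_zero).tendsto.comp hline
  have hL := (h.differentiableAt h0).continuousAt.tendsto.comp hline
  refine (((hL.pow 2).mul (tendsto_clm_apply (tendsto_clm_apply (hD.eval_const v) hslope)
    hslope)).comp tendsto_inv_atTop_nhdsGT_zero).congr' ?_
  filter_upwards [eventually_gt_atTop 0] with t ht
  have hne : sharp B α + t⁻¹ • v ≠ 0 := by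
    rw [← inv_smul_smul₀ ht.ne' (sharp B α), ← smul_add, add_comm]
    exact smul_ne_zero (inv_ne_zero ht.ne') (add_smul_ne_zero hv t)
  have := h.wronskian_inv (v := v) (inv_pos.2 ht) hne (gradSq L α (sharp B α))
  rw [inv_inv] at this
  simp only [Function.comp_apply, this, inv_inv]

lemma exists_tendsto_wronskian (hv : LinearIndependent ℝ ![sharp B α, v]) :
    ∃ l : ℝ, Tendsto (wronskian L (formEnergy B) (sharp B α) v) atTop (𝓝 l) ∧
      Tendsto (wronskian L (formEnergy B) (sharp B α) (-v)) atTop (𝓝 (-l)) := by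
  refine ⟨_, h.tendsto_wronskian hv, ?_⟩
  convert h.tendsto_wronskian (LinearIndependent.pair_neg_right_iff.2 hv) using 2
  simp

lemma exists_wronskian_eq (hv : LinearIndependent ℝ ![sharp B α, v]) :
    ∃ l : ℝ, (∀ t, wronskian L (formEnergy B) (sharp B α) v t = l) ∧
      ∀ t, wronskian L (formEnergy B) (sharp B α) (-v) t = -l := by
  have hv' := LinearIndependent.pair_neg_right_iff.2 hv
  obtain ⟨l, hl, hl'⟩ := h.exists_tendsto_wronskian hv
  obtain ⟨m, hm, hm'⟩ := h.neg.exists_tendsto_wronskian (v := v)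
    (by simpa [sharp_neg] using hv)
  rw [sharp_neg] at hm hm'
  have tendsto_atBot (u : V) (k : ℝ)
      (hk : Tendsto (wronskian L (formEnergy B) (-sharp B α) u) atTop (𝓝 k)) :
      Tendsto (wronskian L (formEnergy B) (sharp B α) u) atBot (𝓝 (-k)) :=
    (hk.neg.comp tendsto_neg_atBot_atTop).congr fun t => by simp [wronskian_neg]
  have hle (t : ℝ) := (h.antitone_wronskian hv).le_of_tendsto hl t
  have hge (t : ℝ) := (h.antitone_wronskian hv).ge_of_tendsto (tendsto_atBot _ _ hm) t
  have hle' (t : ℝ) := (h.antitone_wronskian hv').le_of_tendsto hl' t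
  have hge' (t : ℝ) := (h.antitone_wronskian hv').ge_of_tendsto (tendsto_atBot _ _ hm') t
  have hlm : l = -m := by linarith [hle 0, hge 0, hle' 0, hge' 0]
  exact ⟨l, fun t => by linarith [hle t, hge t], fun t => by linarith [hle' t, hge' t]⟩

lemma tendsto_gradSq_line (v : V) :
    Tendsto (fun t : ℝ => gradSq L α (v + t • sharp B α)) atTop (𝓝 (gradSq L α (sharp B α))) := by
  have hline : Tendsto (fun t : ℝ => sharp B α + t⁻¹ • v) atTop (𝓝 (sharp B α)) := by
    simpa using ((tendsto_inv_atTop_zero (𝕜 := ℝ)).smul_const v).const_add (sharp B α)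
  refine ((h.differentiableAt_gradSq h.sharp_ne_zero).continuousAt.tendsto.comp hline).congr' ?_
  filter_upwards [eventually_gt_atTop 0] with t ht
  have hscale : sharp B α + t⁻¹ • v = t⁻¹ • (v + t • sharp B α) := by
    rw [smul_add, inv_smul_smul₀ ht.ne', add_comm]
  rw [Function.comp_apply, hscale, h.isPosHomogeneous_gradSq α _ _ (inv_pos.2 ht), zpow_zero,
    one_smul]

lemma gradSq_line_mem_Icc (hv : LinearIndependent ℝ ![sharp B α, v])
    (hw : ∀ t, 0 ≤ wronskian L (formEnergy B) (sharp B α) v t) (t : ℝ) :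
    gradSq L α (v + t • sharp B α) ∈
      Set.Icc (gradSq L α (-sharp B α)) (gradSq L α (sharp B α)) := by
  have hderiv (t : ℝ) := hasDerivAt_comp_line
    (h.differentiableAt_gradSq (α := α) (add_smul_ne_zero hv t))
  have hmono : Monotone fun t : ℝ => gradSq L α (v + t • sharp B α) := by
    refine monotone_of_deriv_nonneg (fun t => (hderiv t).differentiableAt) fun t => ?_
    have hne := add_smul_ne_zero hv t
    have := hw t
    rw [h.wronskian_eq_mul_fderiv _ hne] at this
    rw [(hderiv t).deriv]
    exact nonneg_of_mul_nonneg_right this (pow_pos (h.pos hne) 2)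
  have hbot : Tendsto (fun t : ℝ => gradSq L α (v + t • sharp B α)) atBot
      (𝓝 (gradSq L α (-sharp B α))) := by
    have := (h.neg.tendsto_gradSq_line v).comp tendsto_neg_atBot_atTop
    simpa [Function.comp_def, sharp_neg, gradSq_neg] using this
  exact ⟨hmono.le_of_tendsto hbot t, hmono.ge_of_tendsto (h.tendsto_gradSq_line v) t⟩

/-- Along the lines through `v` and `-v` the function `α(X)` is monotone in opposite senses, with
the same limits `α(X(-X_*))` and `α(X(X_*))` at the ends. -/
lemma gradSq_eq_of_wronskian_eq {l : ℝ} (hv : LinearIndependent ℝ ![sharp B α, v]) (hl : 0 ≤ l)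
    (hw : ∀ t, wronskian L (formEnergy B) (sharp B α) v t = l)
    (hw' : ∀ t, wronskian L (formEnergy B) (sharp B α) (-v) t = -l) :
    gradSq L α v = gradSq L α (sharp B α) ∧ gradSq L α (-v) = gradSq L α (sharp B α) ∧
      gradSq L α (-sharp B α) = gradSq L α (sharp B α) := by
  have hmem := h.gradSq_line_mem_Icc hv (fun t => by rw [hw t]; exact hl) 0
  have hmem' := h.neg.gradSq_line_mem_Icc (v := -v)
    (by simpa [sharp_neg] using hv)
    (fun t => by rw [sharp_neg, ← neg_neg t, wronskian_neg, hw', neg_neg]; exact hl) 0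
  simp only [zero_smul, add_zero, sharp_neg, gradSq_neg, neg_neg, Set.mem_Icc] at hmem hmem'
  refine ⟨?_, ?_, ?_⟩ <;> linarith [hmem.1, hmem.2, hmem'.1, hmem'.2]

lemma gradSq_eq_of_linearIndependent (hv : LinearIndependent ℝ ![sharp B α, v]) :
    gradSq L α v = gradSq L α (sharp B α) ∧
      gradSq L α (-sharp B α) = gradSq L α (sharp B α) := by
  obtain ⟨l, hw, hw'⟩ := h.exists_wronskian_eq hv
  rcases le_total 0 l with hl | hl
  · have := h.gradSq_eq_of_wronskian_eq hv hl hw hw'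
    exact ⟨this.1, this.2.2⟩
  · have := h.gradSq_eq_of_wronskian_eq (LinearIndependent.pair_neg_right_iff.2 hv)
      (neg_nonneg.2 hl) hw' (fun t => by rw [neg_neg, hw t, neg_neg])
    rw [neg_neg] at this
    exact this.2

theorem gradSq_eq_const (hV : 1 < Module.finrank ℝ V) (hy : y ≠ 0) :
    gradSq L α y = gradSq L α (sharp B α) := by
  have h0 := h.sharp_ne_zero
  by_cases hli : LinearIndependent ℝ ![sharp B α, y]
  · exact (h.gradSq_eq_of_linearIndependent hli).1
  obtain ⟨t, rfl⟩ : ∃ t : ℝ, t • sharp B α = y := by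
    simpa [LinearIndependent.pair_iff' h0] using hli
  have hscale {s : ℝ} (hs : 0 < s) (z : V) : gradSq L α (s • z) = gradSq L α z := by
    rw [h.isPosHomogeneous_gradSq α _ _ hs, zpow_zero, one_smul]
  rcases lt_or_gt_of_ne (smul_ne_zero_iff.1 hy).1 with ht | ht
  · obtain ⟨v, hv⟩ := exists_linearIndependent_pair_of_one_lt_finrank hV h0
    rw [← neg_neg t, neg_smul, ← smul_neg, hscale (neg_pos.2 ht),
      (h.gradSq_eq_of_linearIndependent hv).2]
  · exact hscale ht _

lemma gradSq_sharp_pos : 0 < gradSq L α (sharp B α) := h.gradSq_pos h.ne_zero h.sharp_ne_zero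

lemma eq_const_smul_formEnergy (hV : 1 < Module.finrank ℝ V) :
    L = (gradSq L α (sharp B α))⁻¹ • formEnergy B := by
  funext y
  rcases eq_or_ne y 0 with rfl | hy
  · simp [formEnergy, h.map_zero]
  · rw [Pi.smul_apply, smul_eq_mul, ← h.assocEnergy_eq, assocEnergy, h.gradSq_eq_const hV hy]
    field_simp [h.gradSq_sharp_pos.ne']

theorem finslerGrad_eq_smul (hV : 1 < Module.finrank ℝ V) (hy : y ≠ 0) :
    finslerGrad L α y = gradSq L α (sharp B α) • sharp B α := by
  have hhess : hessForm L y = (gradSq L α (sharp B α))⁻¹ • B := by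
    conv_lhs => rw [h.eq_const_smul_formEnergy hV]
    rw [hessForm_const_smul, hessForm_formEnergy h.posDef.symm]
  refine (h.isPosDefForm hy).sharp_eq ?_
  rw [hhess, map_smul, smul_apply, h.posDef.apply_sharp, smul_inv_smul₀ h.gradSq_sharp_pos.ne']

lemma line_eq (hV : 1 < Module.finrank ℝ V) (hαv : α v = 0) (t : ℝ) :
    L (v + t • sharp B α) = (gradSq L α (sharp B α))⁻¹ * (1 / 2 * (B v v + t ^ 2)) := by
  have hvs : B v (sharp B α) = 0 := by rw [h.posDef.symm, h.posDef.apply_sharp, hαv]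
  conv_lhs => rw [h.eq_const_smul_formEnergy hV]
  simp only [formEnergy, Pi.smul_apply, smul_eq_mul, map_add, map_smul, add_apply, smul_apply, hvs,
    h.posDef.apply_sharp, hαv, h.apply_sharp_eq_one]
  ring

end HasAssocForm

section AssocForm

variable [FiniteDimensional ℝ V] {L : V → ℝ} {α : V →L[ℝ] ℝ}

theorem IsMinkowskiEnergy.exists_hasAssocForm (h : IsMinkowskiEnergy L) (hα : α ≠ 0)
    (hV : 1 < Module.finrank ℝ V) (hC : ∀ y, y ≠ 0 → ContDiffAt ℝ 3 (assocEnergy L α) y)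
    (hD : ∀ y, y ≠ 0 → fderiv ℝ (hessForm (assocEnergy L α)) y = 0) :
    ∃ B, HasAssocForm L α B := by
  have hhom : IsTwoHomogeneous (assocEnergy L α) := by
    refine ⟨hC, fun y t ht => ?_⟩
    rw [assocEnergy, h.homogeneous y t ht, h.isPosHomogeneous_gradSq α y t ht, zpow_zero, one_smul,
      smul_mul_assoc, assocEnergy]
  obtain ⟨B, hsymm, hB⟩ := hhom.eq_formEnergy_of_fderiv_hessForm_eq_zero hV hD
  refine ⟨B, h, hα, ⟨hsymm, fun u hu => ?_⟩, hB⟩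
  have hpos : 0 < assocEnergy L α u := mul_pos (h.pos hu) (h.gradSq_pos hα hu)
  rw [hB, formEnergy] at hpos
  linarith

end AssocForm

end Rigidity

section Coordinates

variable {n : ℕ}

lemma clm_ext_single {E : Type*} [NormedAddCommGroup E] [NormedSpace ℝ E] {S T : Vec n →L[ℝ] E}
    (h : ∀ i, S (EuclideanSpace.single i 1) = T (EuclideanSpace.single i 1)) : S = T :=
  ContinuousLinearMap.coe_injective <| (EuclideanSpace.basisFun (Fin n) ℝ).toBasis.ext fun i => by
    simpa using h i

/-- The covector with components `a`. -/
noncomputable def covector (a : Fin n → ℝ) : Vec n →L[ℝ] ℝ := innerSL ℝ (WithLp.toLp 2 a)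

lemma covector_apply (a : Fin n → ℝ) (w : Vec n) : covector a w = ∑ i, w i * a i := by
  simp [covector, PiLp.inner_apply]

lemma covector_single (a : Fin n → ℝ) (i : Fin n) : covector a (EuclideanSpace.single i 1) = a i :=
  by simp [covector_apply]

lemma covector_apply_single (β : Vec n →L[ℝ] ℝ) :
    covector (fun i => β (EuclideanSpace.single i 1)) = β :=
  clm_ext_single fun i => covector_single _ i

section Hess

variable {f : Vec n → ℝ} {y : Vec n} (hf : DifferentiableAt ℝ (fderiv ℝ f) y)
include hf

lemma hess_apply (i j : Fin n) : hess f y i j =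
    hessForm f y (EuclideanSpace.single j 1) (EuclideanSpace.single i 1) := by
  have := hf.hasFDerivAt.clm_apply (hasFDerivAt_const (EuclideanSpace.single i (1 : ℝ)) y)
  have hpd : fderiv ℝ (pd i f) y = _ := this.fderiv
  rw [hess, Matrix.of_apply, pd, hpd]
  simp

lemma hess_mulVec (u : Vec n) (i : Fin n) : Matrix.mulVec (hess f y) u i =
    hessForm f y u (EuclideanSpace.single i 1) := by
  rw [← ContinuousLinearMap.flip_apply,
    ← covector_apply_single ((hessForm f y).flip (EuclideanSpace.single i 1)), covector_apply]
  simp [Matrix.mulVec, dotProduct, hess_apply hf, mul_comm]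

lemma isUnit_hess (hpos : IsPosDefForm (hessForm f y)) : IsUnit (hess f y) := by
  rw [← Matrix.mulVec_injective_iff_isUnit]
  refine (injective_iff_map_eq_zero (Matrix.mulVecLin (hess f y))).2 fun u hu => ?_
  have hzero : hessForm f y (WithLp.toLp 2 u) = 0 := clm_ext_single fun i => by
    rw [← hess_mulVec hf]
    simpa using congrFun hu i
  simpa using congrArg WithLp.ofLp (hpos.injective (hzero.trans (map_zero _).symm))

lemma grad_eq_finslerGrad (hpos : IsPosDefForm (hessForm f y)) (a : Fin n → ℝ) :
    grad f a y = finslerGrad f (covector a) y := by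
  have hmul : Matrix.mulVec (hess f y) (finslerGrad f (covector a) y).ofLp = a := funext fun i => by
    rw [hess_mulVec hf, finslerGrad, hpos.apply_sharp, covector_single]
  have hdet := (Matrix.isUnit_iff_isUnit_det _).1 (isUnit_hess hf hpos)
  nth_rw 1 [grad, ← hmul]
  rw [Matrix.mulVec_mulVec, Matrix.nonsing_inv_mul _ hdet, Matrix.one_mulVec, WithLp.toLp_ofLp]

end Hess

lemma IsMinkowskiEnergy.grad_eq {L : Vec n → ℝ} (h : IsMinkowskiEnergy L) (a : Fin n → ℝ)
    {y : Vec n} (hy : y ≠ 0) : grad L a y = finslerGrad L (covector a) y :=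
  grad_eq_finslerGrad (h.differentiableAt_fderiv hy) (h.isPosDefForm hy) a

lemma IsMinkowskiEnergy.energyStar_eq {L : Vec n → ℝ} (h : IsMinkowskiEnergy L) (a : Fin n → ℝ) :
    energyStar L a = assocEnergy L (covector a) := by
  funext y
  rcases eq_or_ne y 0 with rfl | hy
  · simp [energyStar, assocEnergy, h.map_zero]
  · rw [energyStar, assocEnergy, gradSq, ← covector_apply, h.grad_eq a hy]

namespace HasAssocForm

variable {L : Vec n → ℝ} {a : Fin n → ℝ} {B : Vec n →L[ℝ] Vec n →L[ℝ] ℝ}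
  (h : HasAssocForm L (covector a) B)
include h

lemma energyStar_eq_formEnergy : energyStar L a = formEnergy B := by
  rw [h.toIsMinkowskiEnergy.energyStar_eq, h.assocEnergy_eq]

lemma gradStar_eq_sharp (y : Vec n) : gradStar L a y = sharp B (covector a) := by
  have hhess := hessForm_formEnergy h.posDef.symm y
  rw [gradStar, h.energyStar_eq_formEnergy, grad_eq_finslerGrad
    (((contDiffAt_formEnergy B y).fderiv_right (m := 1) le_rfl).differentiableAt one_ne_zero)
    (by rw [hhess]; exact h.posDef), finslerGrad, hhess]

end HasAssocForm

lemma iteratedFDeriv_three_apply {E : Type*} [NormedAddCommGroup E] [NormedSpace ℝ E]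
    (f : Vec n → E) (y u v w : Vec n) :
    iteratedFDeriv ℝ 3 f y ![u, v, w] = fderiv ℝ (fderiv ℝ (fderiv ℝ f)) y u v w := by
  rw [iteratedFDeriv_succ_apply_right, iteratedFDeriv_two_apply]
  rfl

lemma pd_pd_pd_eq {f : Vec n → ℝ} {y : Vec n} (hf : ContDiffAt ℝ 3 f y) (i j k : Fin n) :
    pd k (pd j (pd i f)) y = iteratedFDeriv ℝ 3 f y
      ![EuclideanSpace.single k 1, EuclideanSpace.single j 1, EuclideanSpace.single i 1] := by
  have hfd : ContDiffAt ℝ 2 (fderiv ℝ f) y := hf.fderiv_right (by norm_num)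
  have hhess : DifferentiableAt ℝ (hessForm f) y :=
    (hfd.fderiv_right (m := 1) (by norm_num)).differentiableAt one_ne_zero
  have hpd : pd j (pd i f) =ᶠ[𝓝 y] fun z =>
      hessForm f z (EuclideanSpace.single j 1) (EuclideanSpace.single i 1) := by
    filter_upwards [hfd.eventually (by simp)] with z hz
    exact hess_apply (hz.differentiableAt two_ne_zero) i j
  have hd := (hhess.hasFDerivAt.clm_apply (hasFDerivAt_const (EuclideanSpace.single j (1 : ℝ)) y)
    ).clm_apply (hasFDerivAt_const (EuclideanSpace.single i (1 : ℝ)) y)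
  rw [pd, hpd.fderiv_eq, hd.fderiv, iteratedFDeriv_three_apply]
  simp

end Coordinates

section SprayField

variable {V : Type*} [NormedAddCommGroup V] [NormedSpace ℝ V]

lemma hasFDerivAt_comp_prodMk_left {G : Type*} [NormedAddCommGroup G] [NormedSpace ℝ G]
    {Φ : V × V → G} {x y : V} (hΦ : DifferentiableAt ℝ Φ (x, y)) :
    HasFDerivAt (fun x' => Φ (x', y)) ((fderiv ℝ Φ (x, y)).comp (.inl ℝ V V)) x :=
  HasFDerivAt.comp x (f := fun x' => (x', y)) hΦ.hasFDerivAt (hasFDerivAt_prodMk_left x y)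

lemma hasFDerivAt_comp_prodMk_right {G : Type*} [NormedAddCommGroup G] [NormedSpace ℝ G]
    {Φ : V × V → G} {x y : V} (hΦ : DifferentiableAt ℝ Φ (x, y)) :
    HasFDerivAt (fun y' => Φ (x, y')) ((fderiv ℝ Φ (x, y)).comp (.inr ℝ V V)) y :=
  HasFDerivAt.comp y (f := fun y' => (x, y')) hΦ.hasFDerivAt (hasFDerivAt_prodMk_right x y)

/-- The covector `yᵏ ∂²Λ/∂yᵐ∂xᵏ - ∂Λ/∂xᵐ`, which is twice the spray with its index lowered. -/
noncomputable def sprayCovector (Λ : V → V → ℝ) (x y : V) : V →L[ℝ] ℝ :=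
  fderiv ℝ (fun x' => fderiv ℝ (Λ x') y) x y - fderiv ℝ (Λ · y) x

/-- The vector `G` whose components are the spray coefficients of the energy `Λ`; the
coordinate-free form of `spray`. -/
noncomputable def sprayField (Λ : V → V → ℝ) (x y : V) : V :=
  (1 / 2 : ℝ) • sharp (hessForm (Λ x) y) (sprayCovector Λ x y)

/-- The function `Λ x y` is smooth in `(x, y)` for `x` in the open set `U` and `y ≠ 0`. -/
structure IsSmoothEnergy (Λ : V → V → ℝ) (U : Set V) : Prop where
  isOpen : IsOpen U
  contDiffOn : ContDiffOn ℝ ∞ (fun z : V × V => Λ z.1 z.2) (U ×ˢ {0}ᶜ)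

namespace IsSmoothEnergy

variable {Λ : V → V → ℝ} {U : Set V} {x y : V} (h : IsSmoothEnergy Λ U) (hx : x ∈ U) (hy : y ≠ 0)
include h hx hy

lemma contDiffAt : ContDiffAt ℝ ∞ (fun z : V × V => Λ z.1 z.2) (x, y) :=
  h.contDiffOn.contDiffAt
    ((h.isOpen.prod isOpen_compl_singleton).mem_nhds (Set.mk_mem_prod hx hy))

lemma differentiableAt : DifferentiableAt ℝ (fun z : V × V => Λ z.1 z.2) (x, y) :=
  (h.contDiffAt hx hy).differentiableAt (by simp)

lemma contDiffAt_fderiv : ContDiffAt ℝ ∞ (fderiv ℝ fun z : V × V => Λ z.1 z.2) (x, y) :=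
  (h.contDiffAt hx hy).fderiv_right (by simp)

lemma contDiffAt_fibre : ContDiffAt ℝ ∞ (Λ x) y :=
  (h.contDiffAt hx hy).comp (f := fun y' => (x, y')) y (by fun_prop)

lemma fderiv_fibre :
    fderiv ℝ (Λ x) y = (fderiv ℝ (fun z : V × V => Λ z.1 z.2) (x, y)).comp (.inr ℝ V V) :=
  (hasFDerivAt_comp_prodMk_right (h.differentiableAt hx hy)).fderiv

lemma hasFDerivAt_base : HasFDerivAt (fun x' => Λ x' y)
    ((fderiv ℝ (fun z : V × V => Λ z.1 z.2) (x, y)).comp (.inl ℝ V V)) x :=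
  hasFDerivAt_comp_prodMk_left (h.differentiableAt hx hy)

lemma hasFDerivAt_fderiv_fibre : HasFDerivAt (fun x' => fderiv ℝ (Λ x') y)
    (((ContinuousLinearMap.compL ℝ V (V × V) ℝ).flip (.inr ℝ V V)).comp
      ((fderiv ℝ (fderiv ℝ fun z : V × V => Λ z.1 z.2) (x, y)).comp (.inl ℝ V V))) x := by
  have hd := hasFDerivAt_comp_prodMk_left
    ((h.contDiffAt_fderiv hx hy).differentiableAt (by simp))
  refine (((ContinuousLinearMap.compL ℝ V (V × V) ℝ).flip (.inr ℝ V V)).hasFDerivAt.comp x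
    hd).congr_of_eventuallyEq ?_
  filter_upwards [h.isOpen.mem_nhds hx] with x' hx' using h.fderiv_fibre hx' hy

lemma sprayCovector_eq : sprayCovector Λ x y =
    (fderiv ℝ (fderiv ℝ fun z : V × V => Λ z.1 z.2) (x, y) (y, 0)).comp (.inr ℝ V V) -
      (fderiv ℝ (fun z : V × V => Λ z.1 z.2) (x, y)).comp (.inl ℝ V V) := by
  rw [sprayCovector, (h.hasFDerivAt_fderiv_fibre hx hy).fderiv, (h.hasFDerivAt_base hx hy).fderiv]
  rfl

lemma contDiffAt_sprayCovector : ContDiffAt ℝ ∞ (sprayCovector Λ x) y := by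
  have hpair : ContDiffAt ℝ ∞ (fun y' : V => (x, y')) y := by fun_prop
  have hfst := (h.contDiffAt_fderiv hx hy).comp (f := fun y' => (x, y')) y hpair
  have hsnd := ((h.contDiffAt_fderiv hx hy).fderiv_right (m := ∞) (by simp)).comp
    (f := fun y' => (x, y')) y hpair
  have hvec : ContDiffAt ℝ ∞ (fun y' : V => (y', (0 : V))) y := by fun_prop
  refine (((hsnd.clm_apply hvec).clm_comp (contDiffAt_const (c := .inr ℝ V V))).sub
    (hfst.clm_comp (contDiffAt_const (c := .inl ℝ V V)))).congr_of_eventuallyEq ?_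
  filter_upwards [isOpen_ne.mem_nhds hy] with z hz using h.sprayCovector_eq hx hz

lemma hasFDerivAt_fderiv_fibre_conformal {A : V → ℝ} (hA : DifferentiableAt ℝ A x) :
    HasFDerivAt (fun x' => fderiv ℝ (fun y => Real.exp (2 * A x') * Λ x' y) y)
      (Real.exp (2 * A x) • fderiv ℝ (fun x' => fderiv ℝ (Λ x') y) x +
        (Real.exp (2 * A x) • (2 : ℝ) • fderiv ℝ A x).smulRight (fderiv ℝ (Λ x) y)) x := by
  have hfibre (x' : V) : fderiv ℝ (fun y => Real.exp (2 * A x') * Λ x' y) y =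
      Real.exp (2 * A x') • fderiv ℝ (Λ x') y :=
    congrFun (fderiv_const_smul_field (𝕜 := ℝ) (f := Λ x') (Real.exp (2 * A x'))) y
  rw [funext hfibre]
  exact (hA.hasFDerivAt.const_mul 2).exp.fun_smul
    (h.hasFDerivAt_fderiv_fibre hx hy).differentiableAt.hasFDerivAt

lemma sprayCovector_conformal {A : V → ℝ} (hA : DifferentiableAt ℝ A x) :
    sprayCovector (fun x y => Real.exp (2 * A x) * Λ x y) x y =
      Real.exp (2 * A x) • (sprayCovector Λ x y + (2 * fderiv ℝ A x y) • fderiv ℝ (Λ x) y -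
        (2 * Λ x y) • fderiv ℝ A x) := by
  have hbase := (hA.hasFDerivAt.const_mul 2).exp.fun_mul (h.hasFDerivAt_base hx hy)
  rw [sprayCovector, sprayCovector, (h.hasFDerivAt_fderiv_fibre_conformal hx hy hA).fderiv,
    hbase.fderiv, (h.hasFDerivAt_base hx hy).fderiv]
  ext w
  simp
  ring

variable [FiniteDimensional ℝ V] (hΛ : IsMinkowskiEnergy (Λ x))
include hΛ

lemma contDiffAt_finslerGrad (α : V →L[ℝ] ℝ) : ContDiffAt ℝ ∞ (finslerGrad (Λ x) α) y :=
  contDiffAt_sharp (((h.contDiffAt_fibre hx hy).fderiv_right (m := ∞) (by simp)).fderiv_right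
    (by simp)) contDiffAt_const (hΛ.isPosDefForm hy)

lemma contDiffAt_assocEnergy (α : V →L[ℝ] ℝ) : ContDiffAt ℝ ∞ (assocEnergy (Λ x) α) y :=
  (h.contDiffAt_fibre hx hy).mul
    (α.contDiff.contDiffAt.comp y (h.contDiffAt_finslerGrad hx hy hΛ α))

lemma contDiffAt_sprayField : ContDiffAt ℝ ∞ (sprayField Λ x) y :=
  (contDiffAt_sharp (((h.contDiffAt_fibre hx hy).fderiv_right (m := ∞) (by simp)).fderiv_right
    (by simp)) (h.contDiffAt_sprayCovector hx hy) (hΛ.isPosDefForm hy)).const_smul _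

lemma sprayField_conformal {A : V → ℝ} (hA : DifferentiableAt ℝ A x) :
    sprayField (fun x y => Real.exp (2 * A x) * Λ x y) x y = sprayField Λ x y +
      (fderiv ℝ A x y • y - Λ x y • finslerGrad (Λ x) (fderiv ℝ A x) y) := by
  have hexp : (0 : ℝ) < Real.exp (2 * A x) := Real.exp_pos _
  have hhess : hessForm (fun y => Real.exp (2 * A x) * Λ x y) y =
      Real.exp (2 * A x) • hessForm (Λ x) y := hessForm_const_smul _ _ _
  have hself : sharp (hessForm (Λ x) y) (fderiv ℝ (Λ x) y) = y :=
    (hΛ.isPosDefForm hy).sharp_eq (hΛ.hessForm_self hy)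
  rw [sprayField, hhess, h.sprayCovector_conformal hx hy hA, (hΛ.isPosDefForm hy).sharp_smul_smul
    hexp, sharp_sub, sharp_add, sharp_smul, sharp_smul, hself, sprayField, finslerGrad]
  module

end IsSmoothEnergy

end SprayField

section BerwaldCurvature

variable {n : ℕ} {Λ : Vec n → Vec n → ℝ}

lemma spray_eq_sprayField {x y : Vec n} (hΛ : IsMinkowskiEnergy (Λ x)) (hy : y ≠ 0)
    (hmixed : DifferentiableAt ℝ (fun x' => fderiv ℝ (Λ x') y) x) (l : Fin n) :
    spray Λ l x y = sprayField Λ x y l := by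
  have hpd (k m : Fin n) : pd k (fun x' => pd m (Λ x') y) x =
      fderiv ℝ (fun x' => fderiv ℝ (Λ x') y) x (EuclideanSpace.single k 1)
        (EuclideanSpace.single m 1) := by
    have hd := hmixed.hasFDerivAt.clm_apply
      (hasFDerivAt_const (EuclideanSpace.single m (1 : ℝ)) x)
    have hd' : fderiv ℝ (fun x' => pd m (Λ x') y) x = _ := hd.fderiv
    rw [pd, hd']
    simp
  have hcoef (m : Fin n) :
      (∑ k, y k * pd k (fun x' => pd m (Λ x') y) x) - pd m (fun x' => Λ x' y) x =
        sprayCovector Λ x y (EuclideanSpace.single m 1) := by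
    rw [sprayCovector, sub_apply, ← ContinuousLinearMap.flip_apply,
      ← covector_apply_single (ContinuousLinearMap.flip _ _), covector_apply]
    simp only [hpd, ContinuousLinearMap.flip_apply]
    rfl
  rw [sprayField, ← covector_apply_single (sprayCovector Λ x y)]
  change _ = (1 / 2) * finslerGrad (Λ x) (covector _) y l
  rw [← hΛ.grad_eq _ hy]
  simp only [spray, hcoef, grad, Matrix.mulVec, dotProduct]

lemma sum_berwaldMixed_mul {G : Vec n → Vec n} {x y : Vec n} (hG : ContDiffAt ℝ 3 G y)
    (hspray : ∀ l, spray Λ l x =ᶠ[𝓝 y] fun z => G z l) (a : Fin n → ℝ) (i j k : Fin n) :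
    ∑ l, berwaldMixed Λ l i j k x y * a l = -covector a (iteratedFDeriv ℝ 3 G y
      ![EuclideanSpace.single k 1, EuclideanSpace.single j 1, EuclideanSpace.single i 1]) := by
  have hcomp (l : Fin n) : berwaldMixed Λ l i j k x y = -(iteratedFDeriv ℝ 3 G y
      ![EuclideanSpace.single k 1, EuclideanSpace.single j 1, EuclideanSpace.single i 1]) l := by
    have hl : ContDiffAt ℝ 3 (spray Λ l x) y :=
      (contDiffAt_euclidean.1 hG l).congr_of_eventuallyEq (hspray l)
    rw [berwaldMixed, pd_pd_pd_eq hl, ((hspray l).iteratedFDeriv ℝ 3).eq_of_nhds]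
    change -iteratedFDeriv ℝ 3 (EuclideanSpace.proj (𝕜 := ℝ) l ∘ G) y _ = _
    rw [ContinuousLinearMap.iteratedFDeriv_comp_left _ hG le_rfl]
    rfl
  simp only [hcomp, covector_apply, neg_mul, Finset.sum_neg_distrib]

lemma fderiv_hessForm_sq (α : Vec n →L[ℝ] ℝ) (y : Vec n) :
    fderiv ℝ (hessForm fun z => α z ^ 2) y = 0 := by
  have hform : (fun z => α z ^ 2) = formEnergy ((2 : ℝ) • α.smulRight α) := funext fun z => by
    simp only [formEnergy, smul_apply, ContinuousLinearMap.smulRight_apply, smul_eq_mul]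
    ring
  have hsymm (u w : Vec n) :
      ((2 : ℝ) • α.smulRight α) u w = ((2 : ℝ) • α.smulRight α) w u := by
    simp only [smul_apply, ContinuousLinearMap.smulRight_apply, smul_eq_mul, mul_comm]
  rw [hform, funext (hessForm_formEnergy hsymm)]
  exact fderiv_const_apply _

lemma fderiv_hessForm_assocEnergy_eq_zero {L : Vec n → ℝ} {α : Vec n →L[ℝ] ℝ} {G G' : Vec n → Vec n}
    {y : Vec n} (hG : ContDiffAt ℝ 3 G y) (hG' : ContDiffAt ℝ 3 G' y)
    (hGG' : G' =ᶠ[𝓝 y] fun z => G z + (α z • z - L z • finslerGrad L α z))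
    (heq : ∀ i j k : Fin n, α (iteratedFDeriv ℝ 3 G' y ![EuclideanSpace.single k 1,
        EuclideanSpace.single j 1, EuclideanSpace.single i 1]) =
      α (iteratedFDeriv ℝ 3 G y ![EuclideanSpace.single k 1,
        EuclideanSpace.single j 1, EuclideanSpace.single i 1])) :
    fderiv ℝ (hessForm (assocEnergy L α)) y = 0 := by
  have hassoc : assocEnergy L α =ᶠ[𝓝 y] (fun z => α z ^ 2) - α ∘ (G' - G) := by
    filter_upwards [hGG'] with z hz
    simp only [Pi.sub_apply, Function.comp_apply, hz, assocEnergy, gradSq, map_sub, map_add,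
      map_smul, smul_eq_mul]
    ring
  have hsq : ContDiffAt ℝ 3 (fun z => α z ^ 2) y := by fun_prop
  have hdiff : ContDiffAt ℝ 3 (G' - G) y := hG'.sub hG
  refine clm_ext_single fun k => clm_ext_single fun j => clm_ext_single fun i => ?_
  rw [← iteratedFDeriv_three_apply, (hassoc.iteratedFDeriv ℝ 3).eq_of_nhds,
    iteratedFDeriv_sub_apply hsq (α.contDiff.contDiffAt.comp y hdiff),
    ContinuousLinearMap.iteratedFDeriv_comp_left _ hdiff le_rfl, iteratedFDeriv_sub_apply hG' hG,
    sub_apply, iteratedFDeriv_three_apply, fderiv_hessForm_sq]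
  simp [heq]

lemma IsSmoothEnergy.fderiv_hessForm_assocEnergy_eq_zero {U : Set (Vec n)}
    (h : IsSmoothEnergy Λ U) {x : Vec n} (hx : x ∈ U) (hΛ : IsMinkowskiEnergy (Λ x)) {A : Vec n → ℝ}
    (hA : DifferentiableAt ℝ A x) {a : Fin n → ℝ} (ha : covector a = fderiv ℝ A x) {y : Vec n}
    (hy : y ≠ 0)
    (hP : ∀ i j k : Fin n,
      ∑ l, berwaldMixed (fun x y => Real.exp (2 * A x) * Λ x y) l i j k x y * a l =
        ∑ l, berwaldMixed Λ l i j k x y * a l) :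
    fderiv ℝ (hessForm (assocEnergy (Λ x) (covector a))) y = 0 := by
  have hne : ∀ᶠ z in 𝓝 y, z ≠ 0 := isOpen_ne.mem_nhds hy
  set Λ' : Vec n → Vec n → ℝ := fun x y => Real.exp (2 * A x) * Λ x y
  have hconf : sprayField Λ' x =ᶠ[𝓝 y] fun z => sprayField Λ x z +
      (covector a z • z - Λ x z • finslerGrad (Λ x) (covector a) z) := by
    filter_upwards [hne] with z hz
    rw [ha]
    exact h.sprayField_conformal hx hz hΛ hA
  have hG : ContDiffAt ℝ ∞ (sprayField Λ x) y := h.contDiffAt_sprayField hx hy hΛ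
  have hG' : ContDiffAt ℝ ∞ (sprayField Λ' x) y :=
    (hG.add (((covector a).contDiff.contDiffAt.smul contDiffAt_id).sub
      ((h.contDiffAt_fibre hx hy).smul (h.contDiffAt_finslerGrad hx hy hΛ _)))
      ).congr_of_eventuallyEq hconf
  have hthree : (3 : WithTop ℕ∞) ≤ ∞ := WithTop.coe_le_coe.2 le_top
  have hspray (l : Fin n) : spray Λ l x =ᶠ[𝓝 y] fun z => sprayField Λ x z l := by
    filter_upwards [hne] with z hz using spray_eq_sprayField hΛ hz
      (h.hasFDerivAt_fderiv_fibre hx hz).differentiableAt l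
  have hspray' (l : Fin n) : spray Λ' l x =ᶠ[𝓝 y] fun z => sprayField Λ' x z l := by
    filter_upwards [hne] with z hz using spray_eq_sprayField (hΛ.const_smul (Real.exp_pos _)) hz
      (h.hasFDerivAt_fderiv_fibre_conformal hx hz hA).differentiableAt l
  refine FinslerConformal.fderiv_hessForm_assocEnergy_eq_zero (hG.of_le hthree)
    (hG'.of_le hthree) hconf fun i j k => neg_injective ?_
  rw [← sum_berwaldMixed_mul (hG'.of_le hthree) hspray', hP,
    sum_berwaldMixed_mul (hG.of_le hthree) hspray]

end BerwaldCurvature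

lemma hessForm_comp_equiv {V W : Type*} [NormedAddCommGroup V] [NormedSpace ℝ V]
    [NormedAddCommGroup W] [NormedSpace ℝ W] (T : V ≃L[ℝ] W) {f : W → ℝ} {v : V}
    (hf : DifferentiableAt ℝ (fderiv ℝ f) (T v)) (u w : V) :
    hessForm (fun y => f (T y)) v u w = hessForm f (T v) (T u) (T w) := by
  have hfd : fderiv ℝ (fun y => f (T y)) = fun y => (fderiv ℝ f (T y)).comp (T : V →L[ℝ] W) :=
    funext fun y => T.comp_right_fderiv (f := f)
  have hcomp : HasFDerivAt (fun y => fderiv ℝ f (T y)) ((fderiv ℝ (fderiv ℝ f) (T v)).comp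
      (T : V →L[ℝ] W)) v := hf.hasFDerivAt.comp v T.hasFDerivAt
  rw [hessForm, hfd, (hcomp.clm_comp (hasFDerivAt_const (T : V →L[ℝ] W) v)).fderiv]
  simp

lemma covector_coordDeriv {n : ℕ} {M : Type*} [TopologicalSpace M]
    (e : OpenPartialHomeomorph M (Vec n)) (α : M → ℝ) (p : M) :
    covector (coordDeriv e α p) = fderiv ℝ (fun x => α (e.symm x)) (e p) :=
  covector_apply_single _

section Manifold

variable {n : ℕ} {M : Type*} [TopologicalSpace M] [ChartedSpace (Vec n) M]
  {F : TangentBundle (𝓡 n) M → ℝ} {e : OpenPartialHomeomorph M (Vec n)}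

lemma mdifferentiable_of_mem_maximalAtlas (he : e ∈ IsManifold.maximalAtlas (𝓡 n) ∞ M) :
    e.MDifferentiable (𝓡 n) (𝓡 n) :=
  ⟨(contMDiffOn_of_mem_maximalAtlas he).mdifferentiableOn (by simp),
    (contMDiffOn_symm_of_mem_maximalAtlas he).mdifferentiableOn (by simp)⟩

lemma contMDiff_mk_tangentBundle :
    ContMDiff 𝓘(ℝ, Vec n × Vec n) (𝓡 n).tangent ∞
      (fun z : Vec n × Vec n => (⟨z.1, z.2⟩ : TangentBundle (𝓡 n) (Vec n))) := by
  convert! contMDiff_tangentBundleModelSpaceHomeomorph_symm (I := 𝓡 n) (n := ∞) using 1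
  exact modelWithCornersSelf_prod

/-- The differential of the inverse of a chart, as a linear isomorphism; on the model side it is
the identification of `ℝⁿ` with a tangent space used in `coordEnergy`. -/
noncomputable def symmDeriv (he : e ∈ IsManifold.maximalAtlas (𝓡 n) ∞ M) {x : Vec n}
    (hx : x ∈ e.target) : Vec n ≃L[ℝ] Vec n :=
  (mdifferentiable_of_mem_maximalAtlas he).symm.mfderiv hx

lemma coordEnergy_eq (he : e ∈ IsManifold.maximalAtlas (𝓡 n) ∞ M) {x : Vec n}
    (hx : x ∈ e.target) (y : Vec n) :
    coordEnergy e F x y = energy F ⟨e.symm x, symmDeriv he hx y⟩ := rfl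

lemma energy_smul [IsManifold (𝓡 n) ∞ M] (hF : IsFinslerMetric F) (q : M)
    (v : TangentSpace (𝓡 n) q) {t : ℝ} (ht : 0 < t) :
    energy F ⟨q, t • v⟩ = t ^ 2 * energy F ⟨q, v⟩ := by
  rw [energy, energy, hF.homogeneous q v t ht]
  ring

lemma contMDiffOn_mk_mfderiv_symm [IsManifold (𝓡 n) ∞ M]
    (he : e ∈ IsManifold.maximalAtlas (𝓡 n) ∞ M) :
    ContMDiffOn 𝓘(ℝ, Vec n × Vec n) (𝓡 n).tangent ∞
      (fun z : Vec n × Vec n => (⟨e.symm z.1, mfderiv (𝓡 n) (𝓡 n) e.symm z.1 z.2⟩ :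
        TangentBundle (𝓡 n) M)) (e.target ×ˢ Set.univ) := by
  have hsymm := (contMDiffOn_symm_of_mem_maximalAtlas he).contMDiffOn_tangentMapWithin (m := ∞)
    (by simp) e.open_target.uniqueMDiffOn
  refine (hsymm.comp contMDiff_mk_tangentBundle.contMDiffOn fun z hz => hz.1).congr fun z hz => ?_
  rw [Function.comp_apply, tangentMapWithin, mfderivWithin_of_isOpen e.open_target hz.1]

lemma isSmoothEnergy_coordEnergy [IsManifold (𝓡 n) ∞ M] (hF : IsFinslerMetric F)
    (he : e ∈ IsManifold.maximalAtlas (𝓡 n) ∞ M) :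
    IsSmoothEnergy (coordEnergy e F) e.target where
  isOpen := e.open_target
  contDiffOn := by
    have hsmooth := hF.smooth.comp ((contMDiffOn_mk_mfderiv_symm he).mono
      (Set.prod_mono_right (Set.subset_univ {0}ᶜ))) fun z hz =>
        (symmDeriv he hz.1).map_ne_zero_iff.2 hz.2
    exact contDiffOn_const.mul (hsmooth.contDiffOn.pow 2)

lemma isMinkowskiEnergy_coordEnergy [IsManifold (𝓡 n) ∞ M] (hF : IsFinslerMetric F)
    (he : e ∈ IsManifold.maximalAtlas (𝓡 n) ∞ M) {x : Vec n} (hx : x ∈ e.target) :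
    IsMinkowskiEnergy (coordEnergy e F x) := by
  set T := symmDeriv he hx with hT
  have hcontDiff (y : Vec n) (hy : y ≠ 0) : ContDiffAt ℝ 3 (coordEnergy e F x) y :=
    ((isSmoothEnergy_coordEnergy hF he).contDiffAt_fibre hx hy).of_le (WithTop.coe_le_coe.2 le_top)
  have henergy : (fun z : Vec n => energy F ⟨e.symm x, z⟩) =
      fun z => coordEnergy e F x (T.symm z) := funext fun z => by
    rw [coordEnergy_eq he hx, ← hT, T.apply_symm_apply]
  refine ⟨⟨hcontDiff, fun y t ht => ?_⟩, fun y w hy hw => ?_⟩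
  · rw [coordEnergy_eq he hx, coordEnergy_eq he hx, map_smul]
    exact energy_smul hF _ _ ht
  · have hpos := hF.convex (e.symm x) (T y) (T w) (T.map_ne_zero_iff.2 hy) (T.map_ne_zero_iff.2 hw)
    have hdiff : DifferentiableAt ℝ (fderiv ℝ (coordEnergy e F x)) (T.symm (T y)) := by
      rw [T.symm_apply_apply]
      exact ((hcontDiff y hy).fderiv_right (m := 2) (by norm_num)).differentiableAt two_ne_zero
    rw [henergy] at hpos
    simpa only [T.symm_apply_apply] using (hessForm_comp_equiv T.symm hdiff _ _).subst hpos

lemma coordEnergy_conformalChange (α : M → ℝ) :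
    coordEnergy e (conformalChange α F) =
      fun x y => Real.exp (2 * α (e.symm x)) * coordEnergy e F x y := by
  funext x y
  simp only [coordEnergy, energy, conformalChange]
  rw [two_mul, Real.exp_add]
  ring

section Point

variable (he : e ∈ IsManifold.maximalAtlas (𝓡 n) ∞ M) {p : M} (hp : p ∈ e.source) {α : M → ℝ}

/-- The linear isomorphism `tangentCoord e p`. -/
noncomputable def chartDeriv : TangentSpace (𝓡 n) p ≃L[ℝ] Vec n :=
  (mdifferentiable_of_mem_maximalAtlas he).mfderiv hp

lemma tangentCoord_eq (v : TangentSpace (𝓡 n) p) : tangentCoord e p v = chartDeriv he hp v := rfl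

lemma tangentBundle_mk_eq {q : M} (hq : q = p) {w v : Vec n} (h : w = v) :
    (⟨q, w⟩ : TangentBundle (𝓡 n) M) = ⟨p, v⟩ := by
  subst hq h; rfl

include he hp

lemma energy_eq_coordEnergy (v : TangentSpace (𝓡 n) p) :
    energy F ⟨p, v⟩ = coordEnergy e F (e p) (tangentCoord e p v) := by
  refine congrArg (energy F) (tangentBundle_mk_eq (e.left_inv hp) ?_).symm
  exact congrArg (fun T => T v) ((mdifferentiable_of_mem_maximalAtlas he).symm_comp_deriv hp)

lemma differentiableAt_comp_symm (hα : MDifferentiableAt (𝓡 n) 𝓘(ℝ, ℝ) α p) :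
    DifferentiableAt ℝ (fun x => α (e.symm x)) (e p) := by
  have hsymm := (mdifferentiable_of_mem_maximalAtlas he).mdifferentiableAt_symm (e.map_source hp)
  rw [← e.left_inv hp] at hα
  exact (hα.comp (e p) hsymm).differentiableAt

lemma covector_coordDeriv_tangentCoord (hα : MDifferentiableAt (𝓡 n) 𝓘(ℝ, ℝ) α p)
    (v : TangentSpace (𝓡 n) p) :
    covector (coordDeriv e α p) (tangentCoord e p v) = mfderiv (𝓡 n) 𝓘(ℝ, ℝ) α p v := by
  have hchain := mfderiv_comp p (differentiableAt_comp_symm he hp hα).mdifferentiableAt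
    ((mdifferentiable_of_mem_maximalAtlas he).mdifferentiableAt hp)
  have heq : ((fun x => α (e.symm x)) ∘ e) =ᶠ[𝓝 p] α := by
    filter_upwards [e.open_source.mem_nhds hp] with q hq
    rw [Function.comp_apply, e.left_inv hq]
  rw [← heq.mfderiv_eq, hchain, covector_coordDeriv, ← mfderiv_eq_fderiv]
  rfl

end Point

end Manifold

section Riccati

variable {c a₂ t : ℝ} {Y Z : ℝ → ℝ}

lemma hasDerivAt_of_quadratic (hY : ∀ s, Y s = c * (1 / 2 * (a₂ + s ^ 2))) (s : ℝ) :
    HasDerivAt Y (c * s) s := by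
  rw [funext hY]
  refine ((((hasDerivAt_pow 2 s).const_add a₂).const_mul (1 / 2)).const_mul c).congr_deriv ?_
  ring

lemma hasDerivAt_deriv_of_quadratic (hY : ∀ s, Y s = c * (1 / 2 * (a₂ + s ^ 2))) (s : ℝ) :
    HasDerivAt (deriv Y) c s := by
  rw [funext fun s => (hasDerivAt_of_quadratic hY s).deriv]
  simpa only [mul_one] using (hasDerivAt_id' s).const_mul c

lemma ode_of_quadratic (hY : ∀ s, Y s = c * (1 / 2 * (a₂ + s ^ 2))) (t : ℝ) :
    a₂ * Y t * deriv (deriv Y) t - 1 / 2 * (a₂ + t ^ 2) * deriv Y t ^ 2 + 2 * t * Y t * deriv Y t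
      - 2 * Y t ^ 2 = 0 := by
  rw [(hasDerivAt_deriv_of_quadratic hY t).deriv, (hasDerivAt_of_quadratic hY t).deriv, hY]
  ring

lemma riccati_of_quadratic (hY : ∀ s, Y s = c * (1 / 2 * (a₂ + s ^ 2)))
    (hZ : ∀ s, Z s = deriv Y s / Y s) (hYt : Y t ≠ 0) :
    DifferentiableAt ℝ Z t ∧
      a₂ * deriv Z t + 1 / 2 * (a₂ - t ^ 2) * Z t ^ 2 + 2 * t * Z t - 2 = 0 := by
  have hdY := hasDerivAt_of_quadratic hY t
  have hdZ : HasDerivAt Z ((c * Y t - deriv Y t * (c * t)) / Y t ^ 2) t := by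
    rw [funext hZ]
    exact (hasDerivAt_deriv_of_quadratic hY t).fun_div hdY hYt
  refine ⟨hdZ.differentiableAt, ?_⟩
  rw [hdZ.deriv, hZ, hdY.deriv]
  have hode := ode_of_quadratic hY t
  rw [(hasDerivAt_deriv_of_quadratic hY t).deriv, hdY.deriv] at hode
  field_simp
  linear_combination 2 * hode

end Riccati

lemma not_linearIndependent_of_smul {n : ℕ} (c : ℝ) (u w : Vec n) :
    ¬ LinearIndependent ℝ ![c • u, u, w] := by
  intro h
  have := Fintype.linearIndependent_iff.1 h ![1, -c, 0] (by simp [Fin.sum_univ_three]) 0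
  simp at this

lemma gramDet_eq_zero_of_smul {n : ℕ} (L : Vec n → ℝ) (y : Vec n) (c : ℝ) (u w : Vec n) :
    gramDet L y ![c • u, u, w] = 0 := by
  have hrow (z : Vec n) : ∑ i, ∑ j, hess L y i j * (c • u) i * z j =
      c * ∑ i, ∑ j, hess L y i j * u i * z j := by
    simp only [Finset.mul_sum, PiLp.smul_apply, smul_eq_mul, mul_assoc, mul_left_comm c]
  rw [gramDet, Matrix.det_fin_three]
  simp only [Matrix.of_apply, Matrix.cons_val, hrow]
  ring

lemma IsPosDefForm.exists_quadraticForm {E V : Type*} [AddCommGroup E] [Module ℝ E]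
    [NormedAddCommGroup V] [NormedSpace ℝ V] {B : V →L[ℝ] V →L[ℝ] ℝ} (hB : IsPosDefForm B)
    (T : E ≃ₗ[ℝ] V) :
    ∃ Q : QuadraticForm ℝ E, Q.PosDef ∧ ∀ v, formEnergy B (T v) = Q v := by
  refine ⟨(1 / 2 : ℝ) • (LinearMap.BilinMap.toQuadraticMap B.toLinearMap₁₂).comp
    (T : E →ₗ[ℝ] V), fun v hv => ?_, fun v => ?_⟩
  · have := hB.pos (T v) (T.map_ne_zero_iff.2 hv)
    simpa using this
  · simp [formEnergy]

namespace HasAssocForm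

section Line

variable {V : Type*} [NormedAddCommGroup V] [NormedSpace ℝ V] [FiniteDimensional ℝ V] {L : V → ℝ}
  {α : V →L[ℝ] ℝ} {B : V →L[ℝ] V →L[ℝ] ℝ} (h : HasAssocForm L α B) {v : V} (hv : α v = 0) {t : ℝ}
  (ht : v ≠ 0 ∨ t ≠ 0)
include h hv ht

lemma line_ne_zero : v + t • sharp B α ≠ 0 := by
  intro h0
  have ht0 : t = 0 := by
    simpa only [map_add, map_smul, hv, h.apply_sharp_eq_one, zero_add, smul_eq_mul, mul_one,
      map_zero] using congrArg α h0
  simp_all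

lemma equations_along_line (hV : 1 < Module.finrank ℝ V) {a₂ b₂ : ℝ} {Y Z : ℝ → ℝ}
    (ha₂ : a₂ = 2 * formEnergy B v) (hb₂ : b₂ = 2 * formEnergy B (sharp B α))
    (hY : ∀ s, Y s = L (v + s • sharp B α)) (hZ : ∀ s, Z s = deriv Y s / Y s) :
    0 < Y t ∧ ContDiffAt ℝ 2 Y t ∧ DifferentiableAt ℝ Z t ∧
      (a₂ + t ^ 2 * b₂ * (1 - b₂)) * Y t * deriv (deriv Y) t
        - (1 / 2) * (a₂ + t ^ 2 * b₂) * deriv Y t ^ 2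
        + 2 * t * b₂ ^ 2 * Y t * deriv Y t - 2 * b₂ ^ 2 * Y t ^ 2 = 0 ∧
      (a₂ + t ^ 2 * b₂ * (1 - b₂)) * deriv Z t
        + (1 / 2) * (a₂ + t ^ 2 * b₂ * (1 - 2 * b₂)) * Z t ^ 2
        + 2 * t * b₂ ^ 2 * Z t - 2 * b₂ ^ 2 = 0 := by
  have ha₂' : B v v = a₂ := by
    rw [ha₂, formEnergy]
    ring
  have hb₂' : b₂ = 1 := by
    rw [hb₂, formEnergy, h.posDef.apply_sharp, h.apply_sharp_eq_one]
    norm_num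
  have hquad (s : ℝ) := (hY s).trans (h.line_eq hV hv s)
  have hpos : 0 < Y t := hY t ▸ h.pos (h.line_ne_zero hv ht)
  have hsmooth : ContDiffAt ℝ 2 Y t := by
    rw [funext hquad]
    fun_prop
  rw [ha₂'] at hquad
  obtain ⟨hdZ, hriccati⟩ := riccati_of_quadratic hquad hZ hpos.ne'
  subst hb₂'
  exact ⟨hpos, hsmooth, hdZ, by linear_combination ode_of_quadratic hquad t,
    by linear_combination hriccati⟩

end Line

lemma grad_gradStar_dependent {n : ℕ} (hn : 2 ≤ n) {L : Vec n → ℝ} {a : Fin n → ℝ}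
    {B : Vec n →L[ℝ] Vec n →L[ℝ] ℝ} (h : HasAssocForm L (covector a) B) {y : Vec n} (hy : y ≠ 0) :
    ¬ LinearIndependent ℝ ![grad L a y, gradStar L a y, y] ∧
      gramDet L y ![grad L a y, gradStar L a y, y] = 0 := by
  rw [h.gradStar_eq_sharp, h.toIsMinkowskiEnergy.grad_eq a hy,
    h.finslerGrad_eq_smul (by rwa [finrank_euclideanSpace_fin]) hy]
  exact ⟨not_linearIndependent_of_smul _ _ _, gramDet_eq_zero_of_smul _ _ _ _ _⟩

end HasAssocForm

lemma exists_hasAssocForm_coordEnergy {n : ℕ} (hn : 2 ≤ n) {M : Type*} [TopologicalSpace M]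
    [ChartedSpace (Vec n) M] [IsManifold (𝓡 n) ∞ M] {F : TangentBundle (𝓡 n) M → ℝ}
    (hF : IsFinslerMetric F) {α : M → ℝ} {p : M} (hα : MDifferentiableAt (𝓡 n) 𝓘(ℝ, ℝ) α p)
    {e : OpenPartialHomeomorph M (Vec n)} (he : e ∈ IsManifold.maximalAtlas (𝓡 n) ∞ M)
    (hp : p ∈ e.source) (hdα : covector (coordDeriv e α p) ≠ 0)
    (hP : ∀ y : Vec n, y ≠ 0 → ∀ i j k : Fin n,
      ∑ l, berwaldMixed (coordEnergy e (conformalChange α F)) l i j k (e p) y *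
          coordDeriv e α p l =
        ∑ l, berwaldMixed (coordEnergy e F) l i j k (e p) y * coordDeriv e α p l) :
    ∃ B, HasAssocForm (coordEnergy e F (e p)) (covector (coordDeriv e α p)) B := by
  have hx := e.map_source hp
  have hsmooth := isSmoothEnergy_coordEnergy hF he
  have hmink := isMinkowskiEnergy_coordEnergy hF he hx
  rw [coordEnergy_conformalChange] at hP
  exact hmink.exists_hasAssocForm hdα (by rwa [finrank_euclideanSpace_fin])
    (fun y hy => (hsmooth.contDiffAt_assocEnergy hx hy hmink _).of_le (WithTop.coe_le_coe.2 le_top))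
    fun y hy => hsmooth.fderiv_hessForm_assocEnergy_eq_zero hx hmink
      (differentiableAt_comp_symm he hp hα) (covector_coordDeriv e α p) hy (hP y hy)

end FinslerConformal

theorem theorem2_general {n : ℕ} (hn : 2 ≤ n)
    {M : Type*} [TopologicalSpace M] [ChartedSpace (Vec n) M] [IsManifold (𝓡 n) ∞ M]
    (F : TangentBundle (𝓡 n) M → ℝ) (hF : IsFinslerMetric F)
    (α : M → ℝ) (p : M) (hdα : mfderiv (𝓡 n) 𝓘(ℝ, ℝ) α p ≠ 0)
    (e : OpenPartialHomeomorph M (Vec n)) (he : e ∈ IsManifold.maximalAtlas (𝓡 n) ∞ M)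
    (hpe : p ∈ e.source)
    (a : Fin n → ℝ) (ha : a = coordDeriv e α p)
    (L : Vec n → ℝ) (hL : L = coordEnergy e F (e p))
    (hP : ∀ y : Vec n, y ≠ 0 → ∀ i j k : Fin n,
      ∑ l, berwaldMixed (coordEnergy e (conformalChange α F)) l i j k (e p) y * a l =
        ∑ l, berwaldMixed (coordEnergy e F) l i j k (e p) y * a l) :
    (∃ Q : QuadraticForm ℝ (TangentSpace (𝓡 n) p), Q.PosDef ∧
      ∀ v : TangentSpace (𝓡 n) p, energyStar L a (tangentCoord e p v) = Q v) ∧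
    ∃ Xs : TangentSpace (𝓡 n) p,
      (∀ v : TangentSpace (𝓡 n) p, v ≠ 0 →
        gradStar L a (tangentCoord e p v) = tangentCoord e p Xs) ∧
      (∀ v : TangentSpace (𝓡 n) p, v ≠ 0 →
        ¬ LinearIndependent ℝ
            ![grad L a (tangentCoord e p v), gradStar L a (tangentCoord e p v),
              tangentCoord e p v] ∧
        gramDet L (tangentCoord e p v)
            ![grad L a (tangentCoord e p v), gradStar L a (tangentCoord e p v),
              tangentCoord e p v] = 0) ∧
      (∀ v : TangentSpace (𝓡 n) p, mfderiv (𝓡 n) 𝓘(ℝ, ℝ) α p v = 0 →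
        ∀ (a2 b2 : ℝ) (Y Z : ℝ → ℝ),
          a2 = 2 * energyStar L a (tangentCoord e p v) →
          b2 = 2 * energyStar L a (tangentCoord e p Xs) →
          (∀ t, Y t = energy F ⟨p, v + t • Xs⟩) →
          (∀ t, Z t = deriv Y t / Y t) →
          ∀ t : ℝ, (v ≠ 0 ∨ t ≠ 0) →
            v + t • Xs ≠ 0 ∧ 0 < Y t ∧ ContDiffAt ℝ 2 Y t ∧ DifferentiableAt ℝ Z t ∧
            (a2 + t ^ 2 * b2 * (1 - b2)) * Y t * deriv (deriv Y) t
              - (1 / 2) * (a2 + t ^ 2 * b2) * deriv Y t ^ 2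
              + 2 * t * b2 ^ 2 * Y t * deriv Y t - 2 * b2 ^ 2 * Y t ^ 2 = 0 ∧
            (a2 + t ^ 2 * b2 * (1 - b2)) * deriv Z t
              + (1 / 2) * (a2 + t ^ 2 * b2 * (1 - 2 * b2)) * Z t ^ 2
              + 2 * t * b2 ^ 2 * Z t - 2 * b2 ^ 2 = 0) := by
  have hα : MDifferentiableAt (𝓡 n) 𝓘(ℝ, ℝ) α p :=
    not_imp_comm.1 mfderiv_zero_of_not_mdifferentiableAt hdα
  have hcov := covector_coordDeriv_tangentCoord he hpe hα
  subst ha hL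
  have ha0 : covector (coordDeriv e α p) ≠ 0 := fun h0 => hdα <| ContinuousLinearMap.ext fun v => by
    rw [← hcov v, h0]
    rfl
  obtain ⟨B, hB⟩ := exists_hasAssocForm_coordEnergy hn hF hα he hpe ha0 hP
  set T := chartDeriv he hpe
  set X := sharp B (covector (coordDeriv e α p))
  have hTX : tangentCoord e p (T.symm X) = X := T.apply_symm_apply X
  rw [hB.energyStar_eq_formEnergy]
  refine ⟨hB.posDef.exists_quadraticForm T.toLinearEquiv, T.symm X,
    fun v _ => (hB.gradStar_eq_sharp _).trans hTX.symm,
    fun v hv => hB.grad_gradStar_dependent hn (T.map_ne_zero_iff.2 hv), ?_⟩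
  intro v hv a2 b2 Y Z ha2 hb2 hY hZ t ht
  have hker : covector (coordDeriv e α p) (T v) = 0 := (hcov v).trans (by rw [hv]; rfl)
  have hline (s : ℝ) : T (v + s • T.symm X) = T v + s • X := by
    rw [map_add, map_smul, T.apply_symm_apply]
  have ht' : T v ≠ 0 ∨ t ≠ 0 := ht.imp_left T.map_ne_zero_iff.2
  refine ⟨T.map_ne_zero_iff.1 (hline t ▸ hB.line_ne_zero hker ht'), hB.equations_along_line hker ht'
    (by rwa [finrank_euclideanSpace_fin]) ha2 (by rw [hb2, hTX]) (fun s => ?_) hZ⟩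
  rw [hY, energy_eq_coordEnergy he hpe, tangentCoord_eq he hpe, hline]

theorem theorem2 {n : ℕ} (hn : 3 ≤ n)
    {M : Type*} [TopologicalSpace M] [ChartedSpace (Vec n) M] [IsManifold (𝓡 n) ∞ M]
    (F : TangentBundle (𝓡 n) M → ℝ) (hF : IsFinslerMetric F)
    (α : M → ℝ) (hα : ContMDiff (𝓡 n) 𝓘(ℝ, ℝ) ∞ α)
    (p : M) (hdα : mfderiv (𝓡 n) 𝓘(ℝ, ℝ) α p ≠ 0)
    -- local coordinates around `p`
    (e : OpenPartialHomeomorph M (Vec n)) (he : e ∈ IsManifold.maximalAtlas (𝓡 n) ∞ M)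
    (hpe : p ∈ e.source)
    -- the components of `dα` at `p`, and the energy of the tangent space at `p`
    (a : Fin n → ℝ) (ha : a = coordDeriv e α p)
    (L : Vec n → ℝ) (hL : L = coordEnergy e F (e p))
    (hcurv : IndicatrixPositivelyCurved L)
    (hP : ∀ y : Vec n, y ≠ 0 → ∀ i j k : Fin n,
      ∑ l, berwaldMixed (coordEnergy e (conformalChange α F)) l i j k (e p) y * a l =
        ∑ l, berwaldMixed (coordEnergy e F) l i j k (e p) y * a l) :
    -- `E_*` is a positive definite quadratic form on the tangent space
    (∃ Q : QuadraticForm ℝ (TangentSpace (𝓡 n) p), Q.PosDef ∧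
      ∀ v : TangentSpace (𝓡 n) p, energyStar L a (tangentCoord e p v) = Q v) ∧
    -- `X_*` depends only on the position
    ∃ Xs : TangentSpace (𝓡 n) p,
      (∀ v : TangentSpace (𝓡 n) p, v ≠ 0 →
        gradStar L a (tangentCoord e p v) = tangentCoord e p Xs) ∧
      -- `X`, `X_*` and `C` are linearly dependent, and their Gram determinant vanishes
      (∀ v : TangentSpace (𝓡 n) p, v ≠ 0 →
        ¬ LinearIndependent ℝ
            ![grad L a (tangentCoord e p v), gradStar L a (tangentCoord e p v),
              tangentCoord e p v] ∧
        gramDet L (tangentCoord e p v)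
            ![grad L a (tangentCoord e p v), gradStar L a (tangentCoord e p v),
              tangentCoord e p v] = 0) ∧
      -- the differential equation of the energy along `c(t) = v + t X_*`, and its Riccati form
      (∀ v : TangentSpace (𝓡 n) p, mfderiv (𝓡 n) 𝓘(ℝ, ℝ) α p v = 0 →
        ∀ (a2 b2 : ℝ) (Y Z : ℝ → ℝ),
          a2 = 2 * energyStar L a (tangentCoord e p v) →
          b2 = 2 * energyStar L a (tangentCoord e p Xs) →
          (∀ t, Y t = energy F ⟨p, v + t • Xs⟩) →
          (∀ t, Z t = deriv Y t / Y t) →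
          ∀ t : ℝ, (v ≠ 0 ∨ t ≠ 0) →
            v + t • Xs ≠ 0 ∧ 0 < Y t ∧ ContDiffAt ℝ 2 Y t ∧ DifferentiableAt ℝ Z t ∧
            (a2 + t ^ 2 * b2 * (1 - b2)) * Y t * deriv (deriv Y) t
              - (1 / 2) * (a2 + t ^ 2 * b2) * deriv Y t ^ 2
              + 2 * t * b2 ^ 2 * Y t * deriv Y t - 2 * b2 ^ 2 * Y t ^ 2 = 0 ∧
            (a2 + t ^ 2 * b2 * (1 - b2)) * deriv Z t
              + (1 / 2) * (a2 + t ^ 2 * b2 * (1 - 2 * b2)) * Z t ^ 2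
              + 2 * t * b2 ^ 2 * Z t - 2 * b2 ^ 2 = 0) :=
  theorem2_general (by omega) F hF α p hdα e he hpe a ha L hL hP
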